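/- Let $M$ be a smooth manifold and $\mathbb{T}M=TM\oplus T^*M$ its generalized tangent bundle, with tautological inner product $\langle X+\alpha,Y+\beta\rangle=\tfrac12(\alpha(Y)+\beta(X))$ and Courant–Dorfman bracket $[\![X+\alpha,Y+\beta]\!]=[X,Y]+\mathcal L_X\beta-i_Yd\alpha$. Put $\tau_C(\mathbf a,\mathbf b,\mathbf c)=\langle[\![\mathbf a,\mathbf b]\!],\mathbf c\rangle$ for $\mathbf a,\mathbf b,\mathbf c\in\Gamma(\mathbb TM)$. For $\varepsilon\in\{\pm1\}^N$, a commuting family of signature $\varepsilon$ is a tuple $\phi=(\phi_1,\dots,\phi_N)$ of commuting smooth sections of $\mathrm{End}(\mathbb TM)$ with $\phi_i^*=\varepsilon_i\phi_i$ with respect to $\langle\cdot,\cdot\rangle$. A polynomial $P=\sum a_{IJK}x^Iy^Jz^K\in\mathbb R[x_1,\dots,x_N,y_1,\dots,y_N,z_1,\dots,z_N]$ acts by $(P\bullet_\phi\tau_C)(\mathbf a,\mathbf b,\mathbf c)=\sum a_{IJK}\,\tau_C(\phi^I\mathbf a,\phi^J\mathbf b,\phi^K\mathbf c)$. Call $P$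 universally tensorial of signature $\varepsilon$ if, for every smooth manifold and every commuting family $\phi$ of signature $\varepsilon$ on it, $P\bullet_\phi\tau_C$ is $C^\infty$-linear in each argument. A commuting family $\phi$ of signature $\varepsilon$ is uniformly integrable if $P\bullet_\phi\tau_C=0$ for every universally tensorial $P$ of signature $\varepsilon$. Proposition. Let $g_1,g_2$ be (not necessarily definite) pseudo-Riemannian metrics on $M$, viewed as isomorphisms $TM\to T^*M$, and let $\phi_i(X+\alpha)=g_i^{-1}(\alpha)+g_i(X)$, $i=1,2$, be the corresponding classical generalized metrics. Assume that $\phi_1\phi_2=\phi_2\phi_1$; equivalently, $T:=g_1^{-1}g_2$ satisfies $T^2=1$. Let $E_\pm\subseteq TM$ be the $\pm1$-eigenbundles of $T$, so that $TM=E_+\oplus E_-$. Then $\phi=(\phi_1,\phi_2)$, a commuting family of signature $(1,1)$, is uniformly integrable if and only if both of the following conditions hold: (i) $[\Gamma(E_+),\Gamma(E_+)]\subseteq\Gamma(E_+)$ and $[\Gamma(E_-),\Gamma(E_-)]\subseteq\Gamma(E_-)$; (ii) for all $X\in\Gamma(E_+)$ and all $Y\in\Gamma(E_-)$, $(\mathcal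 L_Xg_1)|_{E_-\otimes E_-}=0$ and $(\mathcal L_Yg_1)|_{E_+\otimes E_+}=0$. -/

import Mathlib

open Bundle Manifold ContDiff VectorField

noncomputable section
namespace GenGeom
universe u

/-- The model space `ℝⁿ`. -/
abbrev Model (n : ℕ) : Type := EuclideanSpace ℝ (Fin n)

/-- The dual of `ℝⁿ`. -/
abbrev CoModel (n : ℕ) : Type := Model n →L[ℝ] ℝ

/-- The model fibre of `TM ⊕ T^*M`. -/
abbrev GenModel (n : ℕ) : Type := Model n × CoModel n

section Bundles

variable (n : ℕ) (M : Type u) [TopologicalSpace M] [ChartedSpace (Model n) M]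
  [IsManifold (𝓡 n) ∞ M]

/-- The fibre of `TM`. -/
abbrev Tan (x : M) : Type := TangentSpace (𝓡 n) x
/-- The fibre of `T^*M`. -/
abbrev Cotan (x : M) : Type := TangentSpace (𝓡 n) x →L[ℝ] ℝ
/-- The fibre of the generalized tangent bundle `TM ⊕ T^*M`; an element `(X, α)` is `X + α`. -/
abbrev GenTan (x : M) : Type := TangentSpace (𝓡 n) x × (TangentSpace (𝓡 n) x →L[ℝ] ℝ)

/-- Smooth functions. -/
abbrev SmoothFun : Type u := C^∞⟮𝓡 n, M; ℝ⟯
/-- Smooth vector fields. -/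
abbrev VecField : Type u := ContMDiffSection (𝓡 n) (Model n) ∞ (fun x : M => Tan n M x)
/-- Smooth one-forms. -/
abbrev OneForm : Type u := ContMDiffSection (𝓡 n) (CoModel n) ∞ (fun x : M => Cotan n M x)
/-- Smooth sections of the direct sum bundle `TM ⊕ T^*M`. -/
abbrev GenSec : Type u := ContMDiffSection (𝓡 n) (GenModel n) ∞ (fun x : M => GenTan n M x)
/-- Smooth sections of the bundle `End(TM ⊕ T^*M)`. -/
abbrev GenEnd : Type u := ContMDiffSection (𝓡 n) (GenModel n →L[ℝ] GenModel n) ∞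
  (fun x : M => GenTan n M x →L[ℝ] GenTan n M x)
/-- Smooth sections of `T^*M ⊗ T^*M` (symmetry is imposed in `PseudoMetric`). -/
abbrev TwoTensor : Type u := ContMDiffSection (𝓡 n) (Model n →L[ℝ] CoModel n) ∞
  (fun x : M => Tan n M x →L[ℝ] Cotan n M x)

end Bundles

variable {n : ℕ} {M : Type u} [TopologicalSpace M] [ChartedSpace (Model n) M]
  [IsManifold (𝓡 n) ∞ M]

section Smoothness

/-- Smoothness at `x` of a rough vector field. -/
abbrev VecSmoothAt (Z : ∀ x : M, Tan n M x) (x : M) : Prop :=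
  ContMDiffAt (𝓡 n) ((𝓡 n).prod 𝓘(ℝ, Model n)) ∞
    (fun y => TotalSpace.mk' (Model n) (E := fun y : M => Tan n M y) y (Z y)) x

/-- Smoothness at `x` of a rough one-form. -/
abbrev FormSmoothAt (β : ∀ x : M, Cotan n M x) (x : M) : Prop :=
  ContMDiffAt (𝓡 n) ((𝓡 n).prod 𝓘(ℝ, CoModel n)) ∞
    (fun y => TotalSpace.mk' (CoModel n) (E := fun y : M => Cotan n M y) y (β y)) x

/-- Differentiability at `x` of a rough vector field. -/
abbrev VecDiffAt (Z : ∀ x : M, Tan n M x) (x : M) : Prop :=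
  MDifferentiableAt (𝓡 n) ((𝓡 n).prod 𝓘(ℝ, Model n))
    (fun y => TotalSpace.mk' (Model n) (E := fun y : M => Tan n M y) y (Z y)) x

theorem mdiffAt_pair (β : OneForm n M) {Z : ∀ x : M, Tan n M x} {x : M}
    (hZ : VecDiffAt Z x) : MDifferentiableAt (𝓡 n) 𝓘(ℝ) (fun y => β y (Z y)) x := by
  have : MDifferentiableAt (𝓡 n) ((𝓡 n).prod 𝓘(ℝ))
      (fun m => TotalSpace.mk' ℝ (E := Bundle.Trivial M ℝ) m (β m (Z m))) x :=
    MDifferentiableAt.clm_bundle_apply (F₁ := Model n) β.mdifferentiableAt hZ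
  simp only [mdifferentiableAt_totalSpace] at this
  exact this.2

theorem contMDiffAt_pair {β : ∀ x : M, Cotan n M x} {Z : ∀ x : M, Tan n M x} {x : M}
    (hβ : FormSmoothAt β x)
    (hZ : VecSmoothAt Z x) : ContMDiffAt (𝓡 n) 𝓘(ℝ) ∞ (fun y => β y (Z y)) x := by
  have : ContMDiffAt (𝓡 n) ((𝓡 n).prod 𝓘(ℝ)) ∞
      (fun m => TotalSpace.mk' ℝ (E := Bundle.Trivial M ℝ) m (β m (Z m))) x :=
    ContMDiffAt.clm_bundle_apply (F₁ := Model n) hβ hZ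
  simp only [contMDiffAt_totalSpace] at this
  exact this.2

theorem contMDiffAt_mvfderiv {f : M → ℝ} {Z : ∀ x : M, Tan n M x} {x : M}
    (hf : ContMDiffAt (𝓡 n) 𝓘(ℝ) ∞ f x) (hZ : VecSmoothAt Z x) :
    ContMDiffAt (𝓡 n) 𝓘(ℝ) ∞ (fun y => mvfderiv (𝓡 n) f y (Z y)) x := by
  have h1 := hf.mfderiv_const (m := ∞) (by simp)
  have h2 : FormSmoothAt (fun y => mvfderiv (𝓡 n) f y) x := by
    rw [FormSmoothAt, contMDiffAt_hom_bundle]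
    refine ⟨contMDiffAt_id, ?_⟩
    convert h1 using 1
    ext y v
    simp [inTangentCoordinates, ContinuousLinearMap.inCoordinates, mvfderiv]
    rfl
  exact contMDiffAt_pair h2 hZ

/-- A rough one-form is smooth if its pairing with locally smooth vector fields is smooth. -/
theorem contMDiffAt_coform {β : ∀ x : M, Cotan n M x} {x : M}
    (h : ∀ Z : ∀ x : M, Tan n M x, VecSmoothAt Z x → ContMDiffAt (𝓡 n) 𝓘(ℝ) ∞ (fun y => β y (Z y)) x) :
    FormSmoothAt β x := by
  rw [FormSmoothAt, contMDiffAt_hom_bundle]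
  refine ⟨contMDiffAt_id, ?_⟩
  dsimp only
  have key : ∀ e : Model n, ContMDiffAt (𝓡 n) 𝓘(ℝ) ∞ (fun y => ContinuousLinearMap.inCoordinates (Model n) (Tan n M) ℝ (fun _ : M => ℝ) x y x y (β y) e) x := by
    intro e
    refine (h (fun y => (trivializationAt (Model n) (Tan n M) x).symmL ℝ y e) ?_).congr_of_eventuallyEq ?_
    · rw [VecSmoothAt, contMDiffAt_section]
      refine (contMDiffAt_const (c := e)).congr_of_eventuallyEq ?_
      filter_upwards [(trivializationAt (Model n) (Tan n M) x).open_baseSet.mem_nhds (FiberBundle.mem_baseSet_trivializationAt (Model n) (Tan n M) x)] with y hy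
      rw [← (trivializationAt (Model n) (Tan n M) x).continuousLinearMapAt_apply_of_mem ℝ hy, Trivialization.continuousLinearMapAt_symmL _ hy]
    · filter_upwards [(trivializationAt (Model n) (Tan n M) x).open_baseSet.mem_nhds (FiberBundle.mem_baseSet_trivializationAt (Model n) (Tan n M) x)] with y hy
      simp [ContinuousLinearMap.inCoordinates]
  have hsum : ∀ L : CoModel n, L = ∑ i : Fin n, L (EuclideanSpace.single i 1) •
      (EuclideanSpace.proj i : Model n →L[ℝ] ℝ) := by
    intro L
    ext e
    conv_lhs => rw [← (EuclideanSpace.basisFun (Fin n) ℝ).sum_repr e]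
    simp [mul_comm]
  rw [show (fun y => ContinuousLinearMap.inCoordinates (Model n) (Tan n M) ℝ (fun _ : M => ℝ) x y x y (β y)) = _ from funext fun y => hsum _]
  refine ContMDiffAt.sum fun i _ => ?_
  exact (key _).smul contMDiffAt_const

theorem contMDiff_vec (a : GenSec n M) (x : M) : VecSmoothAt (fun x => (a x).1) x := by
  have := (contMDiffAt_section (IB := 𝓡 n) (F := GenModel n) (E := fun x : M => GenTan n M x) x).1 (a.contMDiff x)
  rw [VecSmoothAt, contMDiffAt_section]
  exact (ContinuousLinearMap.fst ℝ (Model n) (CoModel n)).contDiff.contMDiff.contMDiffAt.comp x this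

theorem contMDiff_form (a : GenSec n M) (x : M) : FormSmoothAt (fun x => (a x).2) x := by
  have := (contMDiffAt_section (IB := 𝓡 n) (F := GenModel n) (E := fun x : M => GenTan n M x) x).1 (a.contMDiff x)
  rw [FormSmoothAt, contMDiffAt_section]
  exact (ContinuousLinearMap.snd ℝ (Model n) (CoModel n)).contDiff.contMDiff.contMDiffAt.comp x this

theorem contMDiff_gen {X : ∀ x : M, Tan n M x} {β : ∀ x : M, Cotan n M x} {x : M}
    (hX : VecSmoothAt X x) (hβ : FormSmoothAt β x) :
    ContMDiffAt (𝓡 n) ((𝓡 n).prod 𝓘(ℝ, GenModel n)) ∞ (fun y => TotalSpace.mk' (GenModel n) (E := fun y : M => GenTan n M y) y (X y, β y)) x := by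
  rw [contMDiffAt_section]
  rw [VecSmoothAt, contMDiffAt_section] at hX
  rw [FormSmoothAt, contMDiffAt_section] at hβ
  exact hX.prodMk_space hβ

end Smoothness

section Calculus

theorem lieForm_tensorial (X : VecField n M) (β : OneForm n M) (x : M) :
    TensorialAt (𝓡 n) (Model n) (V := fun y : M => Tan n M y)
      (fun Z => mvfderiv (𝓡 n) (fun y => β y (Z y)) x (X x) - β x (mlieBracket (𝓡 n) X Z x)) x where
  smul := by
    intro f Z hf hZ
    have h1 : (fun y => β y ((f • Z) y)) = f • fun y => β y (Z y) := by
      ext y; simp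
    rw [h1, mvfderiv_smul hf (mdiffAt_pair β hZ), mlieBracket_smul_right hf hZ]
    simp
    ring
  add := by
    intro Z Z' hZ hZ'
    have h1 : (fun y => β y ((Z + Z') y)) = (fun y => β y (Z y)) + fun y => β y (Z' y) := by
      ext y; simp
    rw [h1, mvfderiv_add (mdiffAt_pair β hZ) (mdiffAt_pair β hZ'), mlieBracket_add_right hZ hZ']
    simp
    ring

/-- The Lie derivative of a one-form, `(L_X β)(Z) = X(β(Z)) - β([X, Z])`. -/
def lieForm (X : VecField n M) (β : OneForm n M) (x : M) : Cotan n M x :=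
  TensorialAt.mkHom _ x (lieForm_tensorial X β x)

theorem extD_swap (α : OneForm n M) (x : M) (Y Z : ∀ y : M, Tan n M y) :
    mvfderiv (𝓡 n) (fun y => α y (Z y)) x (Y x) - mvfderiv (𝓡 n) (fun y => α y (Y y)) x (Z x)
        - α x (mlieBracket (𝓡 n) Y Z x) =
      -(mvfderiv (𝓡 n) (fun y => α y (Y y)) x (Z x) - mvfderiv (𝓡 n) (fun y => α y (Z y)) x (Y x)
        - α x (mlieBracket (𝓡 n) Z Y x)) := by
  rw [mlieBracket_swap_apply (V := Y)]
  simp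
  ring

theorem extD_tensorial_right (α : OneForm n M) (x : M) (Y : ∀ y : M, Tan n M y)
    (_hY : VecDiffAt Y x) :
    TensorialAt (𝓡 n) (Model n) (V := fun y : M => Tan n M y)
      (fun Z => mvfderiv (𝓡 n) (fun y => α y (Z y)) x (Y x)
        - mvfderiv (𝓡 n) (fun y => α y (Y y)) x (Z x) - α x (mlieBracket (𝓡 n) Y Z x)) x where
  smul := by
    intro f Z hf hZ
    have h1 : (fun y => α y ((f • Z) y)) = f • fun y => α y (Z y) := by
      ext y; simp
    rw [h1, mvfderiv_smul hf (mdiffAt_pair α hZ), mlieBracket_smul_right hf hZ]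
    simp
    ring
  add := by
    intro Z Z' hZ hZ'
    have h1 : (fun y => α y ((Z + Z') y)) = (fun y => α y (Z y)) + fun y => α y (Z' y) := by
      ext y; simp
    rw [h1, mvfderiv_add (mdiffAt_pair α hZ) (mdiffAt_pair α hZ'), mlieBracket_add_right hZ hZ']
    simp
    ring

theorem extD_tensorial_left (α : OneForm n M) (x : M) (Z : ∀ y : M, Tan n M y)
    (hZ : VecDiffAt Z x) :
    TensorialAt (𝓡 n) (Model n) (V := fun y : M => Tan n M y)
      (fun Y => mvfderiv (𝓡 n) (fun y => α y (Z y)) x (Y x)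
        - mvfderiv (𝓡 n) (fun y => α y (Y y)) x (Z x) - α x (mlieBracket (𝓡 n) Y Z x)) x where
  smul := by
    intro f Y hf hY
    rw [extD_swap, (extD_tensorial_right α x Z hZ).smul hf hY, extD_swap α x Y]
    simp
    ring
  add := by
    intro Y Y' hY hY'
    rw [extD_swap, (extD_tensorial_right α x Z hZ).add hY hY', extD_swap α x Y, extD_swap α x Y']
    ring

/-- The exterior derivative of a one-form, `dα(Y, Z) = Y(α(Z)) - Z(α(Y)) - α([Y, Z])`. -/
def extD (α : OneForm n M) (x : M) : Tan n M x →L[ℝ] Tan n M x →L[ℝ] ℝ :=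
  TensorialAt.mkHom₂ _ x (extD_tensorial_left α x) (extD_tensorial_right α x)

/-- The value of a two-tensor on two differentiable vector fields is differentiable. -/
theorem mdiffAt_pair₂ (h : TwoTensor n M) {Y Z : ∀ x : M, Tan n M x} {x : M}
    (hY : VecDiffAt Y x) (hZ : VecDiffAt Z x) :
    MDifferentiableAt (𝓡 n) 𝓘(ℝ) (fun y => h y (Y y) (Z y)) x := by
  have : MDifferentiableAt (𝓡 n) ((𝓡 n).prod 𝓘(ℝ))
      (fun m => TotalSpace.mk' ℝ (E := Bundle.Trivial M ℝ) m (h m (Y m) (Z m))) x :=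
    MDifferentiableAt.clm_bundle_apply₂ (F₁ := Model n) (F₂ := Model n) h.mdifferentiableAt hY hZ
  simp only [mdifferentiableAt_totalSpace] at this
  exact this.2

theorem lieTwo_tensorial_right (X : VecField n M) (h : TwoTensor n M) (x : M) (Y : ∀ y : M, Tan n M y)
    (hY : VecDiffAt Y x) :
    TensorialAt (𝓡 n) (Model n) (V := fun y : M => Tan n M y)
      (fun Z => mvfderiv (𝓡 n) (fun y => h y (Y y) (Z y)) x (X x)
        - h x (mlieBracket (𝓡 n) X Y x) (Z x) - h x (Y x) (mlieBracket (𝓡 n) X Z x)) x where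
  smul := by
    intro f Z hf hZ
    have h1 : (fun y => h y (Y y) ((f • Z) y)) = f • fun y => h y (Y y) (Z y) := by
      ext y; simp
    rw [h1, mvfderiv_smul hf (mdiffAt_pair₂ h hY hZ), mlieBracket_smul_right hf hZ]
    simp
    ring
  add := by
    intro Z Z' hZ hZ'
    have h1 : (fun y => h y (Y y) ((Z + Z') y)) =
        (fun y => h y (Y y) (Z y)) + fun y => h y (Y y) (Z' y) := by
      ext y; simp
    rw [h1, mvfderiv_add (mdiffAt_pair₂ h hY hZ) (mdiffAt_pair₂ h hY hZ'),
      mlieBracket_add_right hZ hZ']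
    simp
    ring

theorem lieTwo_tensorial_left (X : VecField n M) (h : TwoTensor n M) (x : M) (Z : ∀ y : M, Tan n M y)
    (hZ : VecDiffAt Z x) :
    TensorialAt (𝓡 n) (Model n) (V := fun y : M => Tan n M y)
      (fun Y => mvfderiv (𝓡 n) (fun y => h y (Y y) (Z y)) x (X x)
        - h x (mlieBracket (𝓡 n) X Y x) (Z x) - h x (Y x) (mlieBracket (𝓡 n) X Z x)) x where
  smul := by
    intro f Y hf hY
    have h1 : (fun y => h y ((f • Y) y) (Z y)) = f • fun y => h y (Y y) (Z y) := by
      ext y; simp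
    rw [h1, mvfderiv_smul hf (mdiffAt_pair₂ h hY hZ), mlieBracket_smul_right hf hY]
    simp
    ring
  add := by
    intro Y Y' hY hY'
    have h1 : (fun y => h y ((Y + Y') y) (Z y)) =
        (fun y => h y (Y y) (Z y)) + fun y => h y (Y' y) (Z y) := by
      ext y; simp
    rw [h1, mvfderiv_add (mdiffAt_pair₂ h hY hZ) (mdiffAt_pair₂ h hY' hZ),
      mlieBracket_add_right hY hY']
    simp
    ring

/-- The Lie derivative of a two-tensor, `(L_X h)(Y, Z) = X(h(Y, Z)) - h([X, Y], Z) - h(Y, [X, Z])`. -/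
def lieTwo (X : VecField n M) (h : TwoTensor n M) (x : M) : Tan n M x →L[ℝ] Tan n M x →L[ℝ] ℝ :=
  TensorialAt.mkHom₂ _ x (lieTwo_tensorial_left X h x) (lieTwo_tensorial_right X h x)

theorem lieForm_apply (X Z : VecField n M) (β : OneForm n M) (x : M) :
    lieForm X β x (Z x) =
      mvfderiv (𝓡 n) (fun y => β y (Z y)) x (X x) - β x (mlieBracket (𝓡 n) X Z x) :=
  TensorialAt.mkHom_apply (lieForm_tensorial X β x) Z.mdifferentiableAt

theorem extD_apply (α : OneForm n M) (Y Z : VecField n M) (x : M) :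
    extD α x (Y x) (Z x) = mvfderiv (𝓡 n) (fun y => α y (Z y)) x (Y x)
      - mvfderiv (𝓡 n) (fun y => α y (Y y)) x (Z x) - α x (mlieBracket (𝓡 n) Y Z x) :=
  TensorialAt.mkHom₂_apply (extD_tensorial_left α x) (extD_tensorial_right α x)
    Y.mdifferentiableAt Z.mdifferentiableAt

theorem lieTwo_apply (X Y Z : VecField n M) (h : TwoTensor n M) (x : M) :
    lieTwo X h x (Y x) (Z x) = mvfderiv (𝓡 n) (fun y => h y (Y y) (Z y)) x (X x)
      - h x (mlieBracket (𝓡 n) X Y x) (Z x) - h x (Y x) (mlieBracket (𝓡 n) X Z x) :=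
  TensorialAt.mkHom₂_apply (lieTwo_tensorial_left X h x) (lieTwo_tensorial_right X h x)
    Y.mdifferentiableAt Z.mdifferentiableAt

theorem vecSmooth_eventually {Z : ∀ y : M, Tan n M y} {x : M} (hZ : VecSmoothAt Z x) :
    ∀ᶠ y in nhds x, VecDiffAt Z y := by
  have h0 : ContMDiffAt (𝓡 n) ((𝓡 n).prod 𝓘(ℝ, Model n)) 1
      (fun y => TotalSpace.mk' (Model n) (E := fun y : M => Tan n M y) y (Z y)) x :=
    hZ.of_le (by exact_mod_cast le_top)
  have : IsManifold (𝓡 n) 1 M := IsManifold.of_le (n := ∞) (by exact_mod_cast le_top)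
  have h1 := (contMDiffAt_iff_contMDiffAt_nhds (by simp)).1 h0
  filter_upwards [h1] with y hy using hy.mdifferentiableAt one_ne_zero

theorem vecSmooth_bracket {X Z : ∀ y : M, Tan n M y} {x : M} (hX : VecSmoothAt X x)
    (hZ : VecSmoothAt Z x) : VecSmoothAt (mlieBracket (𝓡 n) X Z) x := by
  have : IsManifold (𝓡 n) ((((⊤ : ℕ∞) : WithTop ℕ∞)) + 1) M := by simpa using! (inferInstance : IsManifold (𝓡 n) ∞ M)
  have : IsManifold (𝓡 n) (minSmoothness ℝ 2) M := by
    rw [minSmoothness_of_isRCLikeNormedField]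
    exact IsManifold.of_le (n := ∞) (WithTop.coe_le_coe.2 (le_top : (2 : ℕ∞) ≤ ⊤))
  exact ContMDiffAt.mlieBracket_vectorField (m := ⊤) (n := ⊤) hX hZ (by simp)

theorem formSmooth_lieForm (X : VecField n M) (β : OneForm n M) (x : M) :
    FormSmoothAt (lieForm X β) x := by
  refine contMDiffAt_coform fun Z hZ => ?_
  have h1 : ContMDiffAt (𝓡 n) 𝓘(ℝ) ∞ (fun y => mvfderiv (𝓡 n) (fun y => β y (Z y)) y (X y)
      - β y (mlieBracket (𝓡 n) X Z y)) x :=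
    (contMDiffAt_mvfderiv (contMDiffAt_pair (β.contMDiff x) hZ) (X.contMDiff x)).sub
      (contMDiffAt_pair (β.contMDiff x) (vecSmooth_bracket (X.contMDiff x) hZ))
  refine h1.congr_of_eventuallyEq ?_
  filter_upwards [vecSmooth_eventually hZ] with y hy
  exact TensorialAt.mkHom_apply (lieForm_tensorial X β y) hy

theorem formSmooth_extD (α : OneForm n M) (Y : VecField n M) (x : M) :
    FormSmoothAt (fun y => extD α y (Y y)) x := by
  refine contMDiffAt_coform fun Z hZ => ?_
  have hα := α.contMDiff x
  have hY := Y.contMDiff x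
  have h1 : ContMDiffAt (𝓡 n) 𝓘(ℝ) ∞ (fun y => mvfderiv (𝓡 n) (fun y => α y (Z y)) y (Y y)
        - mvfderiv (𝓡 n) (fun y => α y (Y y)) y (Z y) - α y (mlieBracket (𝓡 n) Y Z y)) x :=
    ((contMDiffAt_mvfderiv (contMDiffAt_pair hα hZ) hY).sub
      (contMDiffAt_mvfderiv (contMDiffAt_pair hα hY) hZ)).sub
      (contMDiffAt_pair hα (vecSmooth_bracket hY hZ))
  refine h1.congr_of_eventuallyEq ?_
  filter_upwards [vecSmooth_eventually hZ] with y hy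
  exact TensorialAt.mkHom₂_apply (extD_tensorial_left α y) (extD_tensorial_right α y)
    (Y.mdifferentiableAt) hy

end Calculus

section Courant

/-- The bracket `[X, Y]` of two smooth vector fields, as a smooth vector field. -/
def lieBr (X Y : VecField n M) : VecField n M :=
  ⟨mlieBracket (𝓡 n) X Y, fun x => vecSmooth_bracket (X.contMDiff x) (Y.contMDiff x)⟩

/-- The anchor: the vector field `X` of the generalized section `X + α`. -/
def anchor (a : GenSec n M) : VecField n M :=
  ⟨fun x => (a x).1, contMDiff_vec a⟩

/-- The one-form `α` of the generalized section `X + α`. -/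
def formPart (a : GenSec n M) : OneForm n M :=
  ⟨fun x => (a x).2, contMDiff_form a⟩

/-- The tautological inner product `⟨X + α, Y + β⟩ = (α(Y) + β(X)) / 2` on a fibre. -/
def taut (x : M) (u v : GenTan n M x) : ℝ := (1 / 2) * (u.2 v.1 + v.2 u.1)

/-- The Courant-Dorfman bracket `⟦X + α, Y + β⟧ = [X, Y] + L_X β - i_Y dα`. -/
def courantBracket (a b : GenSec n M) : GenSec n M where
  toFun x := (lieBr (anchor a) (anchor b) x,
    lieForm (anchor a) (formPart b) x - extD (formPart a) x (anchor b x))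
  contMDiff_toFun x := contMDiff_gen ((lieBr (anchor a) (anchor b)).contMDiff x)
    (ContMDiffAt.sub_section (formSmooth_lieForm (anchor a) (formPart b) x)
      (formSmooth_extD (formPart a) (anchor b) x))

/-- The smooth function `⟨a, b⟩`. -/
def tautFun (a b : GenSec n M) : SmoothFun n M :=
  ⟨fun x => taut x (a x) (b x), fun x => contMDiffAt_const.mul
    ((contMDiffAt_pair (contMDiff_form a x) (contMDiff_vec b x)).add
      (contMDiffAt_pair (contMDiff_form b x) (contMDiff_vec a x)))⟩

/-- The Courant element `τ_C(a, b, c) = ⟨⟦a, b⟧, c⟩`. -/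
def courantElement (a b c : GenSec n M) : SmoothFun n M := tautFun (courantBracket a b) c

/-- The product `f a` of a smooth function and a generalized section. -/
def funSmul (f : SmoothFun n M) (a : GenSec n M) : GenSec n M :=
  ⟨fun x => f x • a x, ContMDiff.smul_section f.contMDiff a.contMDiff⟩

/-- The action of a smooth bundle endomorphism on sections. -/
def endAct (φ : GenEnd n M) : Module.End ℝ (GenSec n M) where
  toFun a := ⟨fun x => φ x (a x), fun x => ContMDiffAt.clm_bundle_apply (F₁ := GenModel n)
    (F₂ := GenModel n) (E₁ := fun y : M => GenTan n M y) (E₂ := fun y : M => GenTan n M y)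
    (φ.contMDiff x) (a.contMDiff x)⟩
  map_add' a b := by
    ext x : 1
    exact map_add (φ x) (a x) (b x)
  map_smul' r a := by
    ext x : 1
    exact map_smul (φ x) r (a x)

/-- `φ = (φ_1, …, φ_N)` is a commuting family of signature `ε`: the `φ_i` commute and
`φ_i^* = ε_i φ_i` for the tautological inner product. -/
structure IsCommutingFamily {N : ℕ} (ε : Fin N → ℤˣ) (φ : Fin N → GenEnd n M) : Prop where
  adjoint : ∀ (i : Fin N) (x : M) (u v : GenTan n M x),
    taut x (φ i x u) v = ((ε i : ℤ) : ℝ) * taut x u (φ i x v)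
  commute : ∀ (i j : Fin N) (x : M) (u : GenTan n M x), φ i x (φ j x u) = φ j x (φ i x u)

/-- `φ^I = φ_1^{I_1} ⋯ φ_N^{I_N}`, acting on sections. -/
def famPow {N : ℕ} (φ : Fin N → GenEnd n M) (I : Fin N → ℕ) : Module.End ℝ (GenSec n M) :=
  (List.ofFn fun i => endAct (φ i) ^ I i).prod

/-- The ring `ℝ[x_1, …, x_N, y_1, …, y_N, z_1, …, z_N]`; the variables `x_i`, `y_i`, `z_i` are
`(0, i)`, `(1, i)`, `(2, i)`. -/
abbrev PolyRing (N : ℕ) : Type := MvPolynomial (Fin 3 × Fin N) ℝ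

/-- The action `P • τ` of a polynomial `P = ∑ c_{IJK} x^I y^J z^K` on a trilinear form `τ`:
`(P • τ)(a, b, c) = ∑ c_{IJK} τ(φ^I a, φ^J b, φ^K c)`. -/
def polyAct {N : ℕ} (φ : Fin N → GenEnd n M) (P : PolyRing N)
    (τ : GenSec n M → GenSec n M → GenSec n M → SmoothFun n M) (a b c : GenSec n M) :
    SmoothFun n M :=
  ∑ m ∈ P.support, P.coeff m • τ (famPow φ (fun i => m (0, i)) a)
    (famPow φ (fun i => m (1, i)) b) (famPow φ (fun i => m (2, i)) c)

/-- `τ` is linear over the smooth functions in each argument, that is, `τ` is a tensor. -/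
structure IsTensor (τ : GenSec n M → GenSec n M → GenSec n M → SmoothFun n M) : Prop where
  add₁ : ∀ a a' b c, τ (a + a') b c = τ a b c + τ a' b c
  add₂ : ∀ a b b' c, τ a (b + b') c = τ a b c + τ a b' c
  add₃ : ∀ a b c c', τ a b (c + c') = τ a b c + τ a b c'
  smul₁ : ∀ f a b c, τ (funSmul f a) b c = f * τ a b c
  smul₂ : ∀ f a b c, τ a (funSmul f b) c = f * τ a b c
  smul₃ : ∀ f a b c, τ a b (funSmul f c) = f * τ a b c

end Courant

/-- The universally tensorial polynomials of signature `ε`: those `P` for which `P • τ_C` is a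
tensor for all commuting families of signature `ε` on all smooth manifolds. Up to diffeomorphism
every (Hausdorff, second countable) manifold lives in `Type`. -/
def universallyTensorial {N : ℕ} (ε : Fin N → ℤˣ) : Set (PolyRing N) :=
  {P | ∀ (n : ℕ) (M : Type) [TopologicalSpace M] [T2Space M] [SecondCountableTopology M]
    [ChartedSpace (Model n) M] [IsManifold (𝓡 n) ∞ M] (φ : Fin N → GenEnd n M),
    IsCommutingFamily ε φ → IsTensor (polyAct φ P courantElement)}

/-- The polynomials `P` for which `P • τ_C` vanishes identically. -/
def vanishingPolys {N : ℕ} (φ : Fin N → GenEnd n M) : Set (PolyRing N) :=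
  {P | ∀ a b c : GenSec n M, polyAct φ P courantElement a b c = 0}

/-- Uniform integrability of a commuting family of signature `ε`. -/
def UniformlyIntegrable {N : ℕ} (ε : Fin N → ℤˣ) (φ : Fin N → GenEnd n M) : Prop :=
  universallyTensorial ε ⊆ vanishingPolys φ

section Metrics

variable (n M) in
/-- A (not necessarily definite) smooth metric on `M`. -/
structure PseudoMetric where
  /-- the underlying smooth two-tensor -/
  toTwoTensor : TwoTensor n M
  symm : ∀ (x : M) (u v : Tan n M x), toTwoTensor x u v = toTwoTensor x v u
  nondegenerate : ∀ (x : M) (u : Tan n M x), (∀ v : Tan n M x, toTwoTensor x u v = 0) → u = 0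

/-- The isomorphism `g : TM → T^*M` on a fibre. -/
def PseudoMetric.flat (g : PseudoMetric n M) (x : M) : Tan n M x ≃ₗ[ℝ] Cotan n M x :=
  have : T2Space (Tan n M x) := inferInstanceAs (T2Space (Model n))
  have : FiniteDimensional ℝ (Tan n M x) := inferInstanceAs (FiniteDimensional ℝ (Model n))
  have : FiniteDimensional ℝ (Cotan n M x) := inferInstanceAs (FiniteDimensional ℝ (CoModel n))
  LinearEquiv.ofInjectiveOfFinrankEq (g.toTwoTensor x).toLinearMap
    ((injective_iff_map_eq_zero _).2 fun u hu => g.nondegenerate x u fun v =>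
      DFunLike.congr_fun (F := Cotan n M x) hu v)
    (((LinearMap.toContinuousLinearMap :
      (Tan n M x →ₗ[ℝ] ℝ) ≃ₗ[ℝ] Cotan n M x).finrank_eq.symm.trans Subspace.dual_finrank_eq).symm)

theorem PseudoMetric.flat_apply (g : PseudoMetric n M) (x : M) (v : Tan n M x) :
    g.flat x v = g.toTwoTensor x v := rfl

/-- `φ` is the classical generalized metric with matrix `[[0, g⁻¹], [g, 0]]` in the splitting
`TM ⊕ T^*M`. -/
def IsClassicalMetric (φ : GenEnd n M) (g : PseudoMetric n M) : Prop :=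
  ∀ (x : M) (v : Tan n M x) (α : Cotan n M x), φ x (v, α) = ((g.flat x).symm α, g.flat x v)

/-- The endomorphism `T = g₁⁻¹ g₂` of `TM`. -/
def productStructure (g₁ g₂ : PseudoMetric n M) (x : M) : Module.End ℝ (Tan n M x) :=
  ((g₂.flat x).trans (g₁.flat x).symm).toLinearMap

/-- The distribution `E_s = ker (T - s)`; `E_+` and `E_-` are the cases `s = 1` and `s = -1`. -/
def eigenDist (g₁ g₂ : PseudoMetric n M) (s : ℝ) (x : M) : Submodule ℝ (Tan n M x) :=
  (productStructure g₁ g₂ x).eigenspace s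

/-- The smooth vector fields with values in the distribution `E`. -/
def sectionsOf (E : ∀ x : M, Submodule ℝ (Tan n M x)) : Set (VecField n M) :=
  {X | ∀ x, X x ∈ E x}

/-- `[Γ(E), Γ(E)] ⊆ Γ(E)`. -/
def IsInvolutive (E : ∀ x : M, Submodule ℝ (Tan n M x)) : Prop :=
  ∀ X ∈ sectionsOf E, ∀ Y ∈ sectionsOf E, lieBr X Y ∈ sectionsOf E

/-- `(L_X g)|_{E ⊗ E} = 0`. -/
def LieVanishesOn (X : VecField n M) (g : PseudoMetric n M)
    (E : ∀ x : M, Submodule ℝ (Tan n M x)) : Prop :=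
  ∀ x : M, ∀ u ∈ E x, ∀ v ∈ E x, lieTwo X g.toTwoTensor x u v = 0

end Metrics

end GenGeom
end

/-!
Since `φ₁` and `φ₂` are commuting involutions, `TM ⊕ T^*M` splits into four joint eigenbundles
`V_s`, `s ∈ {±1}²`, and smooth sections split accordingly (`eigensection_induction`). On sections
of `V_s`, `V_t`, `V_u` a polynomial `P` acts on `τ_C` through the number `P(s, t, u)`
(`polyAct_eigensections`). So uniform integrability only depends on which values `P(s, t, u)` can
be nonzero for a universally tensorial `P`.

* If two of `s, t, u` coincide, then `P(s, t, u) = 0`. The failure of `C^∞`-linearity of `τ_C`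
  consists of terms `ρ(a) f ⟨b, c⟩`. On the line, a commuting family can be chosen to have
  eigenvalues `s` on `∂ + dx` and `t` on `∂ - dx` for any prescribed `s` and `t`, and there one such
  term survives (`eval_eq_zero_of_mem_universallyTensorial`).
* If `s, t, u` are pairwise distinct, then `P(s, t, u) ≠ 0` for the Vandermonde polynomial
  `(ℓ(x) - ℓ(y)) (ℓ(y) - ℓ(z)) (ℓ(x) - ℓ(z))`, where `ℓ = X₁ + 2 X₂` separates the points of
  `{±1}²`. It is universally tensorial because `φ₁ + 2 φ₂` is self-adjoint, so that each factor
  annihilates one kind of derivative term (`vandermondePoly_mem`).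

Hence `φ` is uniformly integrable if and only if `τ_C` vanishes on all triples of eigensections with
pairwise distinct eigenvalues. A section of `V_s` has the form `X + s₁ g₁(X)` with `X` in the
`s₁ s₂`-eigenbundle of `T`. Three distinct points of `{±1}²` give two vector fields `X, Y` in one
eigenbundle, with opposite signs in front of `g₁`, and a third one `Z` in the opposite, orthogonal
eigenbundle, with a sign `ζ`. In this situation `τ_C` is, up to sign and a factor `1/2`,
`ζ g₁([X, Y], Z) ± (L_Z g₁)(X, Y)` (`courantElement_graph_right` and its two companions). Both signs
`ζ` occur, so the two terms vanish separately: the first is involutivity of the eigenbundles, as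
each of them is the orthogonal complement of the other, and the second is the condition on Lie
derivatives. Since vectors in an eigenbundle extend to global sections of it
(`exists_sectionsOf_eigenDist`), the vanishing for sections is equivalent to these conditions.
-/

open Bundle Manifold ContDiff VectorField

noncomputable section
namespace GenGeom
universe u

section

/-! ### Multiplication by constants -/

variable {n : ℕ} {M : Type u} [TopologicalSpace M] [ChartedSpace (Model n) M]

theorem smul_eq_const_mul (r : ℝ) (f : SmoothFun n M) :
    r • f = (ContMDiffMap.const r : SmoothFun n M) * f := by
  ext x
  rfl

theorem mvfderiv_const_smul_apply (r : ℝ) {f : M → ℝ} {x : M}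
    (hf : MDifferentiableAt (𝓡 n) 𝓘(ℝ) f x) (v : Tan n M x) :
    mvfderiv (𝓡 n) (fun y => r * f y) x v = r * mvfderiv (𝓡 n) f x v := by
  have h : mvfderiv (𝓡 n) (fun y => r * f y) x v =
      (r • mvfderiv (𝓡 n) f x + (mvfderiv (𝓡 n) (fun _ : M => r) x).smulRight (f x)) v :=
    congrArg (fun L => L v) (mvfderiv_smul (mdifferentiableAt_const (c := r)) hf)
  rw [mvfderiv_const] at h
  simpa using h

theorem mvfderiv_eq_zero_of_forall {f : M → ℝ} (hf : ∀ y, f y = 0) (x : M) (v : Tan n M x) :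
    mvfderiv (𝓡 n) f x v = 0 := by
  obtain rfl : f = 0 := funext hf
  rw [mvfderiv_zero]
  rfl

end

section

variable {n : ℕ} {M : Type u} [TopologicalSpace M] [ChartedSpace (Model n) M]
  [IsManifold (𝓡 n) ∞ M]

/-! ### The Courant element as a trilinear map, and its failure to be tensorial -/

-- Instance search does not find this scalar action within its default budget.
instance : MulAction ℝ (GenSec n M) :=
  (inferInstance : Module ℝ (GenSec n M)).toDistribMulAction.toMulAction

theorem vecDiffAt_anchor (a : GenSec n M) (x : M) : VecDiffAt (fun y => (a y).1) x :=
  (anchor a).mdifferentiableAt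

theorem mdiffAt_form_apply (a b : GenSec n M) (x : M) :
    MDifferentiableAt (𝓡 n) 𝓘(ℝ) (fun y => (a y).2 (b y).1) x :=
  mdiffAt_pair (formPart a) (vecDiffAt_anchor b x)

/-- The Courant element in terms of Lie brackets and derivatives of functions, from Cartan's
formulas for `L_X β` and `dα`. -/
theorem courantElement_apply (a b c : GenSec n M) (x : M) :
    courantElement a b c x = (1 / 2) * (
      (c x).2 (mlieBracket (𝓡 n) (fun y => (a y).1) (fun y => (b y).1) x)
      + mvfderiv (𝓡 n) (fun y => (b y).2 (c y).1) x (a x).1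
      - (b x).2 (mlieBracket (𝓡 n) (fun y => (a y).1) (fun y => (c y).1) x)
      - mvfderiv (𝓡 n) (fun y => (a y).2 (c y).1) x (b x).1
      + mvfderiv (𝓡 n) (fun y => (a y).2 (b y).1) x (c x).1
      + (a x).2 (mlieBracket (𝓡 n) (fun y => (b y).1) (fun y => (c y).1) x)) := by
  have h1 := lieForm_apply (anchor a) (anchor c) (formPart b) x
  have h2 := extD_apply (formPart a) (anchor b) (anchor c) x
  change (1 / 2) * ((lieForm (anchor a) (formPart b) x - extD (formPart a) x (anchor b x))
    (anchor c x) + (c x).2 (mlieBracket (𝓡 n) (fun y => (a y).1) (fun y => (b y).1) x)) = _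
  rw [_root_.sub_apply, h1, h2]
  change (1 / 2) * (mvfderiv (𝓡 n) (fun y => (b y).2 (c y).1) x (a x).1
    - (b x).2 (mlieBracket (𝓡 n) (fun y => (a y).1) (fun y => (c y).1) x)
    - (mvfderiv (𝓡 n) (fun y => (a y).2 (c y).1) x (b x).1
      - mvfderiv (𝓡 n) (fun y => (a y).2 (b y).1) x (c x).1
      - (a x).2 (mlieBracket (𝓡 n) (fun y => (b y).1) (fun y => (c y).1) x))
    + (c x).2 (mlieBracket (𝓡 n) (fun y => (a y).1) (fun y => (b y).1) x)) = _
  ring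

theorem courantElement_add_left (a a' b c : GenSec n M) :
    courantElement (a + a') b c = courantElement a b c + courantElement a' b c := by
  ext x
  change _ = courantElement a b c x + courantElement a' b c x
  simp only [courantElement_apply]
  have h1 : (fun y => ((a + a') y).1) = (fun y => (a y).1) + fun y => (a' y).1 := rfl
  have h2 (d : GenSec n M) : (fun y => ((a + a') y).2 (d y).1) =
    (fun y => (a y).2 (d y).1) + fun y => (a' y).2 (d y).1 := rfl
  have h3 : (a + a') x = a x + a' x := rfl
  rw [h1, h2, h2, mlieBracket_add_left (vecDiffAt_anchor a x) (vecDiffAt_anchor a' x),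
    mlieBracket_add_left (vecDiffAt_anchor a x) (vecDiffAt_anchor a' x),
    mvfderiv_add (mdiffAt_form_apply a c x) (mdiffAt_form_apply a' c x),
    mvfderiv_add (mdiffAt_form_apply a b x) (mdiffAt_form_apply a' b x), h3]
  simp only [Prod.fst_add, Prod.snd_add, map_add, _root_.add_apply]
  ring

theorem courantElement_add_middle (a b b' c : GenSec n M) :
    courantElement a (b + b') c = courantElement a b c + courantElement a b' c := by
  ext x
  change _ = courantElement a b c x + courantElement a b' c x
  simp only [courantElement_apply]
  have h1 : (fun y => ((b + b') y).1) = (fun y => (b y).1) + fun y => (b' y).1 := rfl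
  have h2 : (fun y => ((b + b') y).2 (c y).1) =
    (fun y => (b y).2 (c y).1) + fun y => (b' y).2 (c y).1 := rfl
  have h4 : (fun y => (a y).2 ((b + b') y).1) =
    (fun y => (a y).2 (b y).1) + fun y => (a y).2 (b' y).1 := funext fun y => map_add (a y).2 _ _
  have h3 : (b + b') x = b x + b' x := rfl
  rw [h1, h2, h4, mlieBracket_add_left (vecDiffAt_anchor b x) (vecDiffAt_anchor b' x),
    mlieBracket_add_right (vecDiffAt_anchor b x) (vecDiffAt_anchor b' x),
    mvfderiv_add (mdiffAt_form_apply b c x) (mdiffAt_form_apply b' c x),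
    mvfderiv_add (mdiffAt_form_apply a b x) (mdiffAt_form_apply a b' x), h3]
  simp only [Prod.fst_add, Prod.snd_add, map_add, _root_.add_apply]
  ring

theorem tautFun_add_right (a b b' : GenSec n M) :
    tautFun a (b + b') = tautFun a b + tautFun a b' := by
  ext x
  change (1 / 2) * ((a x).2 ((b x).1 + (b' x).1) + ((b x).2 + (b' x).2) (a x).1) =
    (1 / 2) * ((a x).2 (b x).1 + (b x).2 (a x).1) +
      (1 / 2) * ((a x).2 (b' x).1 + (b' x).2 (a x).1)
  rw [map_add, _root_.add_apply]
  ring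

theorem tautFun_funSmul_right (f : SmoothFun n M) (a b : GenSec n M) :
    tautFun a (funSmul f b) = f * tautFun a b := by
  ext x
  change (1 / 2) * ((a x).2 (f x • (b x).1) + (f x • (b x).2) (a x).1) =
    f x * ((1 / 2) * ((a x).2 (b x).1 + (b x).2 (a x).1))
  rw [map_smul, _root_.smul_apply, smul_eq_mul, smul_eq_mul]
  ring

/-- The derivative `ρ(a) f` of a function along the vector field part of a section. -/
def anchorDeriv (a : GenSec n M) (f : SmoothFun n M) : SmoothFun n M :=
  ⟨fun x => mvfderiv (𝓡 n) f x (a x).1,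
    fun x => contMDiffAt_mvfderiv (f.contMDiff x) (contMDiff_vec a x)⟩

/-- In its first argument `τ_C` fails to be tensorial by `⟨a, b⟩ ρ(c) f - ⟨a, c⟩ ρ(b) f`. -/
theorem courantElement_funSmul_left (f : SmoothFun n M) (a b c : GenSec n M) :
    courantElement (funSmul f a) b c = f * courantElement a b c
      - anchorDeriv b f * tautFun a c + anchorDeriv c f * tautFun a b := by
  ext x
  change courantElement (funSmul f a) b c x = f x * courantElement a b c x
    - mvfderiv (𝓡 n) f x (b x).1 * ((1 / 2) * ((a x).2 (c x).1 + (c x).2 (a x).1))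
    + mvfderiv (𝓡 n) f x (c x).1 * ((1 / 2) * ((a x).2 (b x).1 + (b x).2 (a x).1))
  simp only [courantElement_apply]
  have hf : MDifferentiableAt (𝓡 n) 𝓘(ℝ) f x := f.contMDiff.mdifferentiableAt (by simp)
  have h1 : (fun y => ((funSmul f a) y).1) = (f : M → ℝ) • (fun y => (a y).1) := rfl
  have h2 (d : GenSec n M) : (fun y => ((funSmul f a) y).2 (d y).1) =
    (f : M → ℝ) • (fun y => (a y).2 (d y).1) := rfl
  have h3 : (funSmul f a) x = f x • a x := rfl
  rw [h1, h2, h2, mlieBracket_smul_left hf (vecDiffAt_anchor a x),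
    mlieBracket_smul_left hf (vecDiffAt_anchor a x),
    mvfderiv_smul hf (mdiffAt_form_apply a c x),
    mvfderiv_smul hf (mdiffAt_form_apply a b x), h3]
  simp only [Prod.smul_fst, Prod.smul_snd, map_add, map_smul, _root_.add_apply,
    _root_.smul_apply, ContinuousLinearMap.smulRight_apply, smul_eq_mul, map_neg,
    neg_smul]
  ring

/-- In its second argument `τ_C` fails to be tensorial by `⟨b, c⟩ ρ(a) f`. -/
theorem courantElement_funSmul_middle (f : SmoothFun n M) (a b c : GenSec n M) :
    courantElement a (funSmul f b) c = f * courantElement a b c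
      + anchorDeriv a f * tautFun b c := by
  ext x
  change courantElement a (funSmul f b) c x = f x * courantElement a b c x
    + mvfderiv (𝓡 n) f x (a x).1 * ((1 / 2) * ((b x).2 (c x).1 + (c x).2 (b x).1))
  simp only [courantElement_apply]
  have hf : MDifferentiableAt (𝓡 n) 𝓘(ℝ) f x := f.contMDiff.mdifferentiableAt (by simp)
  have h1 : (fun y => ((funSmul f b) y).1) = (f : M → ℝ) • (fun y => (b y).1) := rfl
  have h2 : (fun y => ((funSmul f b) y).2 (c y).1) =
    (f : M → ℝ) • (fun y => (b y).2 (c y).1) := rfl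
  have h4 : (fun y => (a y).2 ((funSmul f b) y).1) =
    (f : M → ℝ) • (fun y => (a y).2 (b y).1) := funext fun y => map_smul (a y).2 _ _
  have h3 : (funSmul f b) x = f x • b x := rfl
  rw [h1, h2, h4, mlieBracket_smul_left hf (vecDiffAt_anchor b x),
    mlieBracket_smul_right hf (vecDiffAt_anchor b x),
    mvfderiv_smul hf (mdiffAt_form_apply b c x),
    mvfderiv_smul hf (mdiffAt_form_apply a b x), h3]
  simp only [Prod.smul_fst, Prod.smul_snd, map_add, map_smul, _root_.add_apply,
    _root_.smul_apply, ContinuousLinearMap.smulRight_apply, smul_eq_mul, map_neg,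
    neg_smul]
  ring

theorem anchorDeriv_const (a : GenSec n M) (r : ℝ) :
    anchorDeriv a (ContMDiffMap.const r) = 0 := by
  ext x
  change mvfderiv (𝓡 n) (fun _ : M => r) x (a x).1 = 0
  rw [mvfderiv_const]
  rfl

theorem smul_eq_funSmul_const (r : ℝ) (a : GenSec n M) :
    r • a = funSmul (ContMDiffMap.const r) a := rfl

variable (n M) in
/-- The Courant element `τ_C`, bundled as an `ℝ`-trilinear map. -/
def courantTri : GenSec n M →ₗ[ℝ] GenSec n M →ₗ[ℝ] GenSec n M →ₗ[ℝ] SmoothFun n M :=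
  LinearMap.mk₂ ℝ
    (fun a b =>
      { toFun := fun c => courantElement a b c
        map_add' := fun c c' => tautFun_add_right _ c c'
        map_smul' := fun r c => by
          rw [smul_eq_funSmul_const, RingHom.id_apply, smul_eq_const_mul]
          exact tautFun_funSmul_right _ _ c })
    (fun a a' b => LinearMap.ext fun c => courantElement_add_left a a' b c)
    (fun r a b => LinearMap.ext fun c => by
      change courantElement (r • a) b c = r • courantElement a b c
      rw [smul_eq_funSmul_const, courantElement_funSmul_left, anchorDeriv_const,
        anchorDeriv_const, smul_eq_const_mul]
      ring)
    (fun a b b' => LinearMap.ext fun c => courantElement_add_middle a b b' c)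
    (fun r a b => LinearMap.ext fun c => by
      change courantElement a (r • b) c = r • courantElement a b c
      rw [smul_eq_funSmul_const, courantElement_funSmul_middle, anchorDeriv_const,
        smul_eq_const_mul]
      ring)

theorem courantTri_apply (a b c : GenSec n M) :
    courantTri n M a b c = courantElement a b c := rfl

/-! ### Joint eigensections -/

theorem famPow_two (φ : Fin 2 → GenEnd n M) (I : Fin 2 → ℕ) (a : GenSec n M) :
    famPow φ I a = (endAct (φ 0) ^ I 0) ((endAct (φ 1) ^ I 1) a) := by
  simp [famPow, List.ofFn_succ]

/-- The global section `a` lies in the joint eigenbundle of `φ` with eigenvalues `s`. -/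
def IsEigensection {N : ℕ} (φ : Fin N → GenEnd n M) (s : Fin N → ℝ) (a : GenSec n M) : Prop :=
  ∀ i, endAct (φ i) a = s i • a

theorem pow_apply_of_apply_eq_smul {V : Type*} [AddCommGroup V] [Module ℝ V]
    (f : Module.End ℝ V) {r : ℝ} {a : V} (h : f a = r • a) (k : ℕ) : (f ^ k) a = r ^ k • a := by
  induction k with
  | zero => simp
  | succ k ih => rw [pow_succ, Module.End.mul_apply, h, map_smul, ih, smul_smul, pow_succ']

theorem IsEigensection.famPow_apply {φ : Fin 2 → GenEnd n M} {s : Fin 2 → ℝ} {a : GenSec n M}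
    (h : IsEigensection φ s a) (I : Fin 2 → ℕ) : famPow φ I a = (∏ i, s i ^ I i) • a := by
  rw [famPow_two, pow_apply_of_apply_eq_smul _ (h 1), map_smul,
    pow_apply_of_apply_eq_smul _ (h 0), smul_smul, Fin.prod_univ_two, mul_comm]

/-- On joint eigensections a polynomial acts by its value at the triple of eigenvalues. -/
theorem polyAct_eigensections {φ : Fin 2 → GenEnd n M} {s t u : Fin 2 → ℝ} {a b c : GenSec n M}
    (ha : IsEigensection φ s a) (hb : IsEigensection φ t b) (hc : IsEigensection φ u c)
    (P : PolyRing 2) : polyAct φ P courantElement a b c =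
      MvPolynomial.eval (fun p : Fin 3 × Fin 2 => ![s, t, u] p.1 p.2) P •
        courantElement a b c := by
  simp only [polyAct, ha.famPow_apply, hb.famPow_apply, hc.famPow_apply, ← courantTri_apply,
    map_smul, LinearMap.smul_apply, MvPolynomial.eval_eq', Finset.sum_smul, smul_smul,
    Fintype.prod_prod_type, Fin.prod_univ_three]
  refine Finset.sum_congr rfl fun m _ => ?_
  congr 1
  simp only [Matrix.cons_val]
  ring

/-! ### Multiplication by linear forms in the polynomial action -/

/-- The action `P ↦ (P • τ_C)(a, b, c)` as a linear map on polynomials. -/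
def polyActLinear (φ : Fin 2 → GenEnd n M) (a b c : GenSec n M) :
    PolyRing 2 →ₗ[ℝ] SmoothFun n M :=
  (MvPolynomial.basisMonomials (Fin 3 × Fin 2) ℝ).constr ℝ fun m =>
    courantTri n M (famPow φ (fun i => m (0, i)) a)
    (famPow φ (fun i => m (1, i)) b) (famPow φ (fun i => m (2, i)) c)

theorem polyActLinear_apply (φ : Fin 2 → GenEnd n M) (a b c : GenSec n M) (P : PolyRing 2) :
    polyActLinear φ a b c P = polyAct φ P courantElement a b c := by
  rw [polyActLinear, Module.Basis.constr_apply]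
  rfl

theorem polyActLinear_monomial (φ : Fin 2 → GenEnd n M) (a b c : GenSec n M)
    (m : Fin 3 × Fin 2 →₀ ℕ) : polyActLinear φ a b c (MvPolynomial.monomial m 1) =
    courantTri n M (famPow φ (fun i => m (0, i)) a)
    (famPow φ (fun i => m (1, i)) b) (famPow φ (fun i => m (2, i)) c) := by
  rw [polyActLinear, ← congrFun (MvPolynomial.coe_basisMonomials (Fin 3 × Fin 2) ℝ) m,
    Module.Basis.constr_basis]

theorem polyActLinear_one (φ : Fin 2 → GenEnd n M) (a b c : GenSec n M) :
    polyActLinear φ a b c 1 = courantTri n M a b c := by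
  rw [MvPolynomial.one_def, polyActLinear_monomial]
  simp [famPow_two]

theorem polyActLinear_add_left (φ : Fin 2 → GenEnd n M) (a a' b c : GenSec n M) (P : PolyRing 2) :
    polyActLinear φ (a + a') b c P = polyActLinear φ a b c P + polyActLinear φ a' b c P := by
  rw [← LinearMap.add_apply]
  congr 1
  refine (MvPolynomial.basisMonomials (Fin 3 × Fin 2) ℝ).ext fun m => ?_
  simp [polyActLinear_monomial]

theorem polyActLinear_add_middle (φ : Fin 2 → GenEnd n M) (a b b' c : GenSec n M)
    (P : PolyRing 2) :
    polyActLinear φ a (b + b') c P = polyActLinear φ a b c P + polyActLinear φ a b' c P := by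
  rw [← LinearMap.add_apply]
  congr 1
  refine (MvPolynomial.basisMonomials (Fin 3 × Fin 2) ℝ).ext fun m => ?_
  simp [polyActLinear_monomial]

theorem polyActLinear_add_right (φ : Fin 2 → GenEnd n M) (a b c c' : GenSec n M)
    (P : PolyRing 2) :
    polyActLinear φ a b (c + c') P = polyActLinear φ a b c P + polyActLinear φ a b c' P := by
  rw [← LinearMap.add_apply]
  congr 1
  refine (MvPolynomial.basisMonomials (Fin 3 × Fin 2) ℝ).ext fun m => ?_
  simp [polyActLinear_monomial]

theorem pow_succ_apply_pow_apply {V : Type*} [AddCommGroup V] [Module ℝ V]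
    {f g : Module.End ℝ V} (h : Commute f g) (p q : ℕ) (a : V) :
    (f ^ (1 + p)) ((g ^ q) a) = (f ^ p) ((g ^ q) (f a)) := by
  have hfg : f ^ (1 + p) * g ^ q = f ^ p * (g ^ q * f) := by
    rw [add_comm, pow_succ, mul_assoc, (h.pow_right q).eq]
  exact LinearMap.congr_fun hfg a

/-- Multiplying a monomial by the variable `(k, i)` inserts `φ_i` into the `k`-th argument. -/
theorem famPow_single_add {φ : Fin 2 → GenEnd n M}
    (h : Commute (endAct (φ 0)) (endAct (φ 1))) (k : Fin 3) (i : Fin 2)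
    (m : Fin 3 × Fin 2 →₀ ℕ) (a : GenSec n M) :
    famPow φ (fun j => Finsupp.single (k, i) 1 (k, j) + m (k, j)) a =
      famPow φ (fun j => m (k, j)) (endAct (φ i) a) := by
  simp only [famPow_two]
  fin_cases i
  · simpa [Finsupp.single_apply] using pow_succ_apply_pow_apply h (m (k, 0)) (m (k, 1)) a
  · simp [add_comm 1, pow_succ]

/-- The linear form `X_{k,0} + 2 X_{k,1}`, which separates the four points of `{±1}²`. -/
def sepForm (k : Fin 3) : PolyRing 2 :=
  MvPolynomial.X (k, 0) + (2 : ℝ) • MvPolynomial.X (k, 1)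

/-- The operator `φ₁ + 2 φ₂` on sections, through which the forms `sepForm k` act. -/
def sepEnd (φ : Fin 2 → GenEnd n M) : Module.End ℝ (GenSec n M) :=
  endAct (φ 0) + (2 : ℝ) • endAct (φ 1)

theorem sepForm_mul_monomial (k : Fin 3) (m : Fin 3 × Fin 2 →₀ ℕ) :
    sepForm k * MvPolynomial.monomial m 1 =
      MvPolynomial.monomial (Finsupp.single (k, 0) 1 + m) 1 +
        (2 : ℝ) • MvPolynomial.monomial (Finsupp.single (k, 1) 1 + m) 1 := by
  simp [sepForm, add_mul, MvPolynomial.X, MvPolynomial.monomial_mul]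

theorem polyActLinear_sepForm_zero_mul {φ : Fin 2 → GenEnd n M}
    (h : Commute (endAct (φ 0)) (endAct (φ 1))) (a b c : GenSec n M) (P : PolyRing 2) :
    polyActLinear φ a b c (sepForm 0 * P) = polyActLinear φ (sepEnd φ a) b c P := by
  change (polyActLinear φ a b c ∘ₗ LinearMap.mulLeft ℝ (sepForm 0)) P = _
  congr 1
  refine (MvPolynomial.basisMonomials (Fin 3 × Fin 2) ℝ).ext fun m => ?_
  simp [sepForm_mul_monomial, polyActLinear_monomial, famPow_single_add h, sepEnd]

theorem polyActLinear_sepForm_one_mul {φ : Fin 2 → GenEnd n M}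
    (h : Commute (endAct (φ 0)) (endAct (φ 1))) (a b c : GenSec n M) (P : PolyRing 2) :
    polyActLinear φ a b c (sepForm 1 * P) = polyActLinear φ a (sepEnd φ b) c P := by
  change (polyActLinear φ a b c ∘ₗ LinearMap.mulLeft ℝ (sepForm 1)) P = _
  congr 1
  refine (MvPolynomial.basisMonomials (Fin 3 × Fin 2) ℝ).ext fun m => ?_
  simp [sepForm_mul_monomial, polyActLinear_monomial, famPow_single_add h, sepEnd]

theorem polyActLinear_sepForm_two_mul {φ : Fin 2 → GenEnd n M}
    (h : Commute (endAct (φ 0)) (endAct (φ 1))) (a b c : GenSec n M) (P : PolyRing 2) :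
    polyActLinear φ a b c (sepForm 2 * P) = polyActLinear φ a b (sepEnd φ c) P := by
  change (polyActLinear φ a b c ∘ₗ LinearMap.mulLeft ℝ (sepForm 2)) P = _
  congr 1
  refine (MvPolynomial.basisMonomials (Fin 3 × Fin 2) ℝ).ext fun m => ?_
  simp [sepForm_mul_monomial, polyActLinear_monomial, famPow_single_add h, sepEnd]

/-! ### The Vandermonde polynomial is universally tensorial -/

/-- The Vandermonde polynomial `(ℓ(x) - ℓ(y)) (ℓ(y) - ℓ(z)) (ℓ(x) - ℓ(z))` for
`ℓ = X₁ + 2 X₂`. -/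
def vandermondePoly : PolyRing 2 :=
  (sepForm 0 - sepForm 1) * (sepForm 1 - sepForm 2) * (sepForm 0 - sepForm 2)

theorem polyAct_vandermondePoly {φ : Fin 2 → GenEnd n M}
    (h : Commute (endAct (φ 0)) (endAct (φ 1))) (a b c : GenSec n M) :
    polyAct φ vandermondePoly courantElement a b c =
      courantElement (sepEnd φ (sepEnd φ a)) (sepEnd φ b) c
      - courantElement (sepEnd φ (sepEnd φ a)) b (sepEnd φ c)
      - courantElement (sepEnd φ a) (sepEnd φ (sepEnd φ b)) c
      + courantElement (sepEnd φ a) b (sepEnd φ (sepEnd φ c))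
      + courantElement a (sepEnd φ (sepEnd φ b)) (sepEnd φ c)
      - courantElement a (sepEnd φ b) (sepEnd φ (sepEnd φ c)) := by
  have hexp : vandermondePoly = sepForm 0 * (sepForm 0 * (sepForm 1 * 1))
      - sepForm 0 * (sepForm 0 * (sepForm 2 * 1)) - sepForm 0 * (sepForm 1 * (sepForm 1 * 1))
      + sepForm 0 * (sepForm 2 * (sepForm 2 * 1)) + sepForm 1 * (sepForm 1 * (sepForm 2 * 1))
      - sepForm 1 * (sepForm 2 * (sepForm 2 * 1)) := by
    rw [vandermondePoly]
    ring
  rw [← polyActLinear_apply, hexp]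
  simp only [map_add, map_sub, polyActLinear_sepForm_zero_mul h, polyActLinear_sepForm_one_mul h,
    polyActLinear_sepForm_two_mul h, polyActLinear_one, courantTri_apply]

theorem sepEnd_funSmul (φ : Fin 2 → GenEnd n M) (f : SmoothFun n M) (a : GenSec n M) :
    sepEnd φ (funSmul f a) = funSmul f (sepEnd φ a) := by
  ext x : 1
  change φ 0 x (f x • a x) + (2 : ℝ) • φ 1 x (f x • a x) =
    f x • (φ 0 x (a x) + (2 : ℝ) • φ 1 x (a x))
  rw [(φ 0 x).map_smul, (φ 1 x).map_smul, smul_add, smul_comm]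

theorem tautFun_comm (a b : GenSec n M) : tautFun a b = tautFun b a := by
  ext x
  change (1 / 2 : ℝ) * ((a x).2 (b x).1 + (b x).2 (a x).1) =
    (1 / 2 : ℝ) * ((b x).2 (a x).1 + (a x).2 (b x).1)
  rw [add_comm]

theorem tautFun_sepEnd {φ : Fin 2 → GenEnd n M}
    (h : IsCommutingFamily (fun _ => 1) φ) (a b : GenSec n M) :
    tautFun (sepEnd φ a) b = tautFun a (sepEnd φ b) := by
  have key (i : Fin 2) : tautFun (endAct (φ i) a) b = tautFun a (endAct (φ i) b) := by
    ext x
    refine (h.adjoint i x (a x) (b x)).trans ?_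
    rw [Units.val_one, Int.cast_one, one_mul]
    rfl
  have hs (d e : GenSec n M) : tautFun d ((2 : ℝ) • e) = (2 : ℝ) • tautFun d e := by
    rw [smul_eq_funSmul_const, tautFun_funSmul_right, smul_eq_const_mul]
  change tautFun (endAct (φ 0) a + (2 : ℝ) • endAct (φ 1) a) b =
    tautFun a (endAct (φ 0) b + (2 : ℝ) • endAct (φ 1) b)
  rw [tautFun_comm, tautFun_add_right, tautFun_add_right, hs, hs, tautFun_comm b, key,
    tautFun_comm b, key]

theorem IsCommutingFamily.commute_endAct {N : ℕ} {ε : Fin N → ℤˣ} {φ : Fin N → GenEnd n M}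
    (h : IsCommutingFamily ε φ) (i j : Fin N) : Commute (endAct (φ i)) (endAct (φ j)) := by
  ext a x : 2
  exact h.commute i j x (a x)

theorem courantElement_funSmul_right (f : SmoothFun n M) (a b c : GenSec n M) :
    courantElement a b (funSmul f c) = f * courantElement a b c :=
  tautFun_funSmul_right f _ c

/-- The derivative terms that spoil the `C^∞`-linearity of `τ_C` cancel in pairs, each pair being
killed by one factor of the Vandermonde polynomial because `φ₁ + 2 φ₂` is self-adjoint. -/
theorem vandermondePoly_mem : vandermondePoly ∈ universallyTensorial (fun _ : Fin 2 => 1) := by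
  intro n M _ _ _ _ _ φ h
  have hc := h.commute_endAct 0 1
  refine ⟨?_, ?_, ?_, ?_, ?_, ?_⟩
  · intros
    simp only [← polyActLinear_apply, polyActLinear_add_left]
  · intros
    simp only [← polyActLinear_apply, polyActLinear_add_middle]
  · intros
    simp only [← polyActLinear_apply, polyActLinear_add_right]
  · intro f a b c
    simp only [polyAct_vandermondePoly hc, sepEnd_funSmul, courantElement_funSmul_left,
      tautFun_sepEnd h]
    ring
  · intro f a b c
    simp only [polyAct_vandermondePoly hc, sepEnd_funSmul, courantElement_funSmul_middle,
      tautFun_sepEnd h]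
    ring
  · intro f a b c
    simp only [polyAct_vandermondePoly hc, sepEnd_funSmul, courantElement_funSmul_right]
    ring

theorem eval_vandermondePoly (s t u : Fin 2 → ℝ) :
    MvPolynomial.eval (fun p : Fin 3 × Fin 2 => ![s, t, u] p.1 p.2) vandermondePoly =
      (s 0 + 2 * s 1 - (t 0 + 2 * t 1)) * (t 0 + 2 * t 1 - (u 0 + 2 * u 1)) *
        (s 0 + 2 * s 1 - (u 0 + 2 * u 1)) := by
  simp [vandermondePoly, sepForm, MvPolynomial.smul_eval]

/-! ### Trivializations of `TM ⊕ T^*M` and constant sections on `ℝⁿ` -/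

/-- Smoothness at `x` of a rough section of `End(TM ⊕ T^*M)`. -/
abbrev EndSmoothAt (L : ∀ x : M, GenTan n M x →L[ℝ] GenTan n M x) (x : M) : Prop :=
  ContMDiffAt (𝓡 n) ((𝓡 n).prod 𝓘(ℝ, GenModel n →L[ℝ] GenModel n)) ∞
   (fun y => TotalSpace.mk' (GenModel n →L[ℝ] GenModel n)
     (E := fun y : M => GenTan n M y →L[ℝ] GenTan n M y) y (L y)) x

/-- A smooth section of `End(TM ⊕ T^*M)` from a family of endomorphisms of the fibres. -/
def genEndOfSmooth (L : ∀ x : M, GenTan n M x →L[ℝ] GenTan n M x) (h : ∀ x, EndSmoothAt L x) :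
    GenEnd n M :=
  ⟨L, h⟩

/-- The trivialization of `TM ⊕ T^*M` at `x` is that of `TM` on vectors and its inverse transpose
on covectors. -/
theorem genTriv_apply (x y : M) (hy : y ∈ (chartAt (Model n) x).source) (u : GenTan n M y) :
    (trivializationAt (GenModel n) (fun y : M => GenTan n M y) x).continuousLinearMapAt ℝ y u
    = ((trivializationAt (Model n) (Tan n M) x).continuousLinearMapAt ℝ y u.1,
      u.2 ∘L (trivializationAt (Model n) (Tan n M) x).symmL ℝ y) := by
  have hm : y ∈ (trivializationAt (GenModel n) (fun y : M => GenTan n M y) x).baseSet := by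
    exact ⟨hy, hy, trivial⟩
  have hy' : y ∈ (trivializationAt (Model n) (Tan n M) x).baseSet := hy
  rw [Trivialization.continuousLinearMapAt_apply_of_mem ℝ _ hm]
  refine Prod.ext ?_ ?_
  · rw [Trivialization.continuousLinearMapAt_apply_of_mem ℝ _ hy']
    rfl
  · ext w
    change (trivializationAt ℝ (fun _ : M => ℝ) x).continuousLinearMapAt ℝ y
      (u.2 ((trivializationAt (Model n) (Tan n M) x).symmL ℝ y w)) = _
    simp

theorem genTriv_symmL_apply (x y : M) (hy : y ∈ (chartAt (Model n) x).source) (u : GenModel n) :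
    (trivializationAt (GenModel n) (fun y : M => GenTan n M y) x).symmL ℝ y u
    = ((trivializationAt (Model n) (Tan n M) x).symmL ℝ y u.1,
      u.2 ∘L (trivializationAt (Model n) (Tan n M) x).continuousLinearMapAt ℝ y) := by
  have hm : y ∈ (trivializationAt (GenModel n) (fun y : M => GenTan n M y) x).baseSet := by
    exact ⟨hy, hy, trivial⟩
  have hy' : y ∈ (trivializationAt (Model n) (Tan n M) x).baseSet := hy
  have := congrArg ((trivializationAt (GenModel n) (fun y : M => GenTan n M y) x).symmL ℝ y)
    (genTriv_apply x y hy ((trivializationAt (Model n) (Tan n M) x).symmL ℝ y u.1,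
      u.2 ∘L (trivializationAt (Model n) (Tan n M) x).continuousLinearMapAt ℝ y))
  rw [Trivialization.symmL_continuousLinearMapAt _ hm] at this
  rw [this]
  congr 1
  refine Prod.ext ?_ ?_
  · exact (Trivialization.continuousLinearMapAt_symmL _ hy' _).symm
  · ext w
    exact congrArg u.2 (Trivialization.continuousLinearMapAt_symmL _ hy' _).symm

theorem endSmoothAt_of_inCoordinates {L : ∀ x : M, GenTan n M x →L[ℝ] GenTan n M x} {x : M}
    (h : ContMDiffAt (𝓡 n) 𝓘(ℝ, GenModel n →L[ℝ] GenModel n) ∞ (fun y =>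
      ContinuousLinearMap.inCoordinates (GenModel n) (fun y : M => GenTan n M y) (GenModel n)
        (fun y : M => GenTan n M y) x y x y (L y)) x) : EndSmoothAt L x := by
  rw [EndSmoothAt, contMDiffAt_hom_bundle]
  exact ⟨contMDiffAt_id, h⟩

end

theorem vecSmooth_const (n : ℕ) (v : Model n) (x : Model n) :
    VecSmoothAt (M := Model n) (fun _ => v) x :=
  contMDiffAt_vectorSpace_iff_contDiffAt.2 contDiffAt_const

theorem formSmooth_const (n : ℕ) (α : CoModel n) (x : Model n) :
    FormSmoothAt (M := Model n) (fun _ => α) x := by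
  refine contMDiffAt_coform fun Z hZ => ?_
  have := contMDiffAt_vectorSpace_iff_contDiffAt.1 hZ
  exact (α.contDiff.contDiffAt.comp x this).contMDiffAt

theorem endSmoothAt_const {n : ℕ} (L : GenModel n →L[ℝ] GenModel n) (x : Model n) :
    EndSmoothAt (M := Model n) (fun _ => L) x := by
  apply endSmoothAt_of_inCoordinates
  refine (contMDiffAt_const (c := L)).congr_of_eventuallyEq
    (Filter.Eventually.of_forall fun y => ?_)
  have hy : y ∈ (chartAt (Model n) x).source := by rw [chartAt_self_eq]; trivial
  have e1 := TangentBundle.continuousLinearMapAt_model_space (𝕜 := ℝ) (F := Model n) x y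
  have e2 := TangentBundle.symmL_model_space (𝕜 := ℝ) (F := Model n) x y
  have h1 (u : GenModel n) : (trivializationAt (GenModel n)
      (fun y : Model n => GenTan n (Model n) y) x).symmL ℝ y u = u := by
    refine (genTriv_symmL_apply x y hy u).trans (Prod.ext ?_ ?_)
    · exact DFunLike.congr_fun e2 u.1
    · exact ContinuousLinearMap.ext fun w => congrArg u.2 (DFunLike.congr_fun e1 w)
  have h2 (u : GenModel n) : (trivializationAt (GenModel n)
      (fun y : Model n => GenTan n (Model n) y) x).continuousLinearMapAt ℝ y u = u := by
    refine (genTriv_apply x y hy u).trans (Prod.ext ?_ ?_)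
    · exact DFunLike.congr_fun e1 u.1
    · exact ContinuousLinearMap.ext fun w => congrArg u.2 (DFunLike.congr_fun e2 w)
  exact ContinuousLinearMap.ext fun u => (h2 _).trans (congrArg L (h1 u))

/-- The section of `T ℝⁿ ⊕ T^* ℝⁿ` with constant value `u`. -/
def constSec {n : ℕ} (u : GenModel n) : GenSec n (Model n) :=
  ⟨fun _ => u, fun x => contMDiff_gen (vecSmooth_const n u.1 x) (formSmooth_const n u.2 x)⟩

/-- The endomorphism of `T ℝⁿ ⊕ T^* ℝⁿ` with constant value `L`. -/
def constEnd {n : ℕ} (L : GenModel n →L[ℝ] GenModel n) : GenEnd n (Model n) :=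
  genEndOfSmooth (fun _ => L) fun x => endSmoothAt_const L x

/-! ### Commuting families on the line -/

/-- The unit vector of the line. -/
def lineVec : Model 1 := EuclideanSpace.single 0 1

/-- The coordinate of the line. -/
def lineCoord : CoModel 1 := EuclideanSpace.proj 0

theorem lineCoord_lineVec : lineCoord lineVec = 1 := by
  simp [lineCoord, lineVec]

/-- The fibre of the generalized metric of the standard metric on the line, exchanging `∂` and
`dx`. -/
def lineSwap : GenModel 1 →L[ℝ] GenModel 1 :=
  ((ContinuousLinearMap.apply ℝ ℝ lineVec ∘L
      ContinuousLinearMap.snd ℝ (Model 1) (CoModel 1)).smulRight lineVec).prod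
    ((lineCoord ∘L ContinuousLinearMap.fst ℝ (Model 1) (CoModel 1)).smulRight lineCoord)

theorem lineSwap_apply (u : GenModel 1) :
    lineSwap u = (u.2 lineVec • lineVec, lineCoord u.1 • lineCoord) := rfl

/-- The commuting family on the line with eigenvalues `s` on `∂ + dx` and `t` on `∂ - dx`. -/
def lineFamily {N : ℕ} (s t : Fin N → ℝ) (i : Fin N) : GenEnd 1 (Model 1) :=
  constEnd (((s i + t i) / 2) • ContinuousLinearMap.id ℝ (GenModel 1) +
    ((s i - t i) / 2) • lineSwap)

theorem isCommutingFamily_lineFamily {N : ℕ} (s t : Fin N → ℝ) :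
    IsCommutingFamily (fun _ => 1) (lineFamily s t) where
  adjoint i x u v := by
    rw [Units.val_one, Int.cast_one, one_mul]
    have key (p q : ℝ) (u v : GenModel 1) :
        (1 / 2 : ℝ) * ((p • u.2 + q • lineCoord u.1 • lineCoord) v.1 +
          v.2 (p • u.1 + q • u.2 lineVec • lineVec)) =
        (1 / 2 : ℝ) * (u.2 (p • v.1 + q • v.2 lineVec • lineVec) +
          (p • v.2 + q • lineCoord v.1 • lineCoord) u.1) := by
      simp
      ring
    exact key _ _ u v
  commute i j x u := by
    have key (p q p' q' : ℝ) (u : GenModel 1) :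
        (p • ContinuousLinearMap.id ℝ (GenModel 1) + q • lineSwap)
          ((p' • ContinuousLinearMap.id ℝ (GenModel 1) + q' • lineSwap) u) =
        (p' • ContinuousLinearMap.id ℝ (GenModel 1) + q' • lineSwap)
          ((p • ContinuousLinearMap.id ℝ (GenModel 1) + q • lineSwap) u) := by
      simp only [_root_.add_apply, _root_.smul_apply, map_add, map_smul,
        ContinuousLinearMap.id_apply]
      module
    exact key _ _ _ _ u

/-- The section `∂ + r dx` on the line. -/
def lineSec (r : ℝ) : GenSec 1 (Model 1) := constSec (lineVec, r • lineCoord)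

theorem tautFun_lineSec (r r' : ℝ) (x : Model 1) :
    tautFun (lineSec r) (lineSec r') x = (r + r') / 2 := by
  change (1 / 2 : ℝ) * (r * lineCoord lineVec + r' * lineCoord lineVec) = _
  rw [lineCoord_lineVec]
  ring

theorem isEigensection_lineSec_one (s t : Fin 2 → ℝ) :
    IsEigensection (lineFamily s t) s (lineSec 1) := by
  intro i
  ext x : 1
  have key : (((s i + t i) / 2) • ContinuousLinearMap.id ℝ (GenModel 1) +
      ((s i - t i) / 2) • lineSwap) (lineVec, (1 : ℝ) • lineCoord) =
      s i • (lineVec, (1 : ℝ) • lineCoord) := by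
    simp only [_root_.add_apply, _root_.smul_apply, ContinuousLinearMap.id_apply, lineSwap_apply,
      lineCoord_lineVec, one_smul]
    module
  exact key

theorem isEigensection_lineSec_neg_one (s t : Fin 2 → ℝ) :
    IsEigensection (lineFamily s t) t (lineSec (-1)) := by
  intro i
  ext x : 1
  have key : (((s i + t i) / 2) • ContinuousLinearMap.id ℝ (GenModel 1) +
      ((s i - t i) / 2) • lineSwap) (lineVec, (-1 : ℝ) • lineCoord) =
      t i • (lineVec, (-1 : ℝ) • lineCoord) := by
    simp only [_root_.add_apply, _root_.smul_apply, ContinuousLinearMap.id_apply, lineSwap_apply,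
      lineCoord_lineVec, one_smul, smul_eq_mul, mul_one, Prod.smul_mk, Prod.mk_add_mk]
    refine Prod.ext ?_ ?_ <;> dsimp only <;> module
  exact key

/-- The coordinate function of the line. -/
def lineFun : SmoothFun 1 (Model 1) := ⟨lineCoord, lineCoord.contDiff.contMDiff⟩

theorem anchorDeriv_lineSec (r : ℝ) : anchorDeriv (lineSec r) lineFun = 1 := by
  ext x
  have h : mfderiv (𝓡 1) 𝓘(ℝ) lineCoord x = lineCoord := by
    rw [mfderiv_eq_fderiv, ContinuousLinearMap.fderiv]
  have : mvfderiv (𝓡 1) lineCoord x lineVec = 1 := by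
    rw [← lineCoord_lineVec]
    exact DFunLike.congr_fun h lineVec
  exact this

theorem IsEigensection.funSmul {M : Type u} {n N : ℕ} [TopologicalSpace M]
    [ChartedSpace (Model n) M] [IsManifold (𝓡 n) ∞ M] {φ : Fin N → GenEnd n M} {s : Fin N → ℝ}
    {a : GenSec n M} (h : IsEigensection φ s a) (f : SmoothFun n M) :
    IsEigensection φ s (funSmul f a) := by
  intro i
  ext x : 1
  have hx : φ i x (a x) = s i • a x := DFunLike.congr_fun (h i) x
  change φ i x (f x • a x) = s i • f x • a x
  rw [(φ i x).map_smul, hx, smul_comm]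

/-- Universally tensorial polynomials of signature `(1, 1)` vanish wherever two of the three
eigenvalues coincide: otherwise a derivative term of `τ_C` survives on the line. -/
theorem eval_eq_zero_of_mem_universallyTensorial {P : PolyRing 2}
    (hP : P ∈ universallyTensorial (fun _ : Fin 2 => 1)) {s t u : Fin 2 → ℝ}
    (h : s = t ∨ t = u ∨ s = u) :
    MvPolynomial.eval (fun p : Fin 3 × Fin 2 => ![s, t, u] p.1 p.2) P = 0 := by
  have hT (s t : Fin 2 → ℝ) := hP 1 (Model 1) (lineFamily s t) (isCommutingFamily_lineFamily s t)
  have ha := isEigensection_lineSec_one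
  have hb := isEigensection_lineSec_neg_one
  rcases h with rfl | rfl | rfl
  · have h1 := (hT s u).smul₁ lineFun (lineSec 1) (lineSec 1) (lineSec (-1))
    rw [polyAct_eigensections ((ha s u).funSmul _) (ha s u) (hb s u),
      polyAct_eigensections (ha s u) (ha s u) (hb s u), courantElement_funSmul_left,
      anchorDeriv_lineSec, anchorDeriv_lineSec] at h1
    have h2 := DFunLike.congr_fun h1 (0 : Model 1)
    simp only [ContMDiffMap.coe_smul, ContMDiffMap.coe_add, ContMDiffMap.coe_sub,
      ContMDiffMap.coe_mul, ContMDiffMap.coe_one, Pi.smul_apply, Pi.add_apply, Pi.sub_apply,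
      Pi.mul_apply, Pi.one_apply, tautFun_lineSec, smul_eq_mul] at h2
    linarith
  · have h1 := (hT s t).smul₂ lineFun (lineSec 1) (lineSec (-1)) (lineSec (-1))
    rw [polyAct_eigensections (ha s t) ((hb s t).funSmul _) (hb s t),
      polyAct_eigensections (ha s t) (hb s t) (hb s t), courantElement_funSmul_middle,
      anchorDeriv_lineSec] at h1
    have h2 := DFunLike.congr_fun h1 (0 : Model 1)
    simp only [ContMDiffMap.coe_smul, ContMDiffMap.coe_add,
      ContMDiffMap.coe_mul, ContMDiffMap.coe_one, Pi.smul_apply, Pi.add_apply,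
      Pi.mul_apply, Pi.one_apply, tautFun_lineSec, smul_eq_mul] at h2
    linarith
  · have h1 := (hT s t).smul₁ lineFun (lineSec 1) (lineSec (-1)) (lineSec 1)
    rw [polyAct_eigensections ((ha s t).funSmul _) (hb s t) (ha s t),
      polyAct_eigensections (ha s t) (hb s t) (ha s t), courantElement_funSmul_left,
      anchorDeriv_lineSec, anchorDeriv_lineSec] at h1
    have h2 := DFunLike.congr_fun h1 (0 : Model 1)
    simp only [ContMDiffMap.coe_smul, ContMDiffMap.coe_add, ContMDiffMap.coe_sub,
      ContMDiffMap.coe_mul, ContMDiffMap.coe_one, Pi.smul_apply, Pi.add_apply, Pi.sub_apply,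
      Pi.mul_apply, Pi.one_apply, tautFun_lineSec, smul_eq_mul] at h2
    linarith

section

variable {n : ℕ} {M : Type u} [TopologicalSpace M] [ChartedSpace (Model n) M]
  [IsManifold (𝓡 n) ∞ M]

/-! ### The Courant element on graphs of a two-tensor -/

/-- `a = X + ε h(X)` for the two-tensor `h`. -/
def IsGraphOf (h : TwoTensor n M) (ε : ℝ) (a : GenSec n M) : Prop :=
  ∀ y, (a y).2 = ε • h y (a y).1

theorem mdiffAt_twoTensor (h : TwoTensor n M) (a b : GenSec n M) (x : M) :
    MDifferentiableAt (𝓡 n) 𝓘(ℝ) (fun y => h y (a y).1 (b y).1) x :=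
  mdiffAt_pair₂ h (vecDiffAt_anchor a x) (vecDiffAt_anchor b x)

/-- The Koszul-type formula for `τ_C` on sections of graphs of multiples of a two-tensor. -/
theorem IsGraphOf.courantElement_apply {h : TwoTensor n M} {ε δ ζ : ℝ} {a b c : GenSec n M}
    (ha : IsGraphOf h ε a) (hb : IsGraphOf h δ b) (hc : IsGraphOf h ζ c) (x : M) :
    courantElement a b c x = (1 / 2) * (
      ζ * h x (c x).1 (mlieBracket (𝓡 n) (anchor a) (anchor b) x)
      + δ * mvfderiv (𝓡 n) (fun y => h y (b y).1 (c y).1) x (a x).1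
      - δ * h x (b x).1 (mlieBracket (𝓡 n) (anchor a) (anchor c) x)
      - ε * mvfderiv (𝓡 n) (fun y => h y (a y).1 (c y).1) x (b x).1
      + ε * mvfderiv (𝓡 n) (fun y => h y (a y).1 (b y).1) x (c x).1
      + ε * h x (a x).1 (mlieBracket (𝓡 n) (anchor b) (anchor c) x)) := by
  have key {r : ℝ} {d : GenSec n M} (hd : IsGraphOf h r d) (e : GenSec n M) :
      (fun y => (d y).2 (e y).1) = fun y => r * h y (d y).1 (e y).1 := by
    ext y
    rw [hd y]
    rfl
  rw [GenGeom.courantElement_apply, key hb, key ha, key ha,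
    mvfderiv_const_smul_apply _ (mdiffAt_twoTensor h b c x),
    mvfderiv_const_smul_apply _ (mdiffAt_twoTensor h a c x),
    mvfderiv_const_smul_apply _ (mdiffAt_twoTensor h a b x), ha x, hb x, hc x]
  rfl

/-- If `Z` is `h`-orthogonal to `X` and `Y`, then `2 τ_C(X + ε h(X), Y - ε h(Y), Z + ζ h(Z))` equals
`ζ h([X, Y], Z) + ε (L_Z h)(X, Y)`. -/
theorem courantElement_graph_right {h : TwoTensor n M}
    (hs : ∀ (x : M) (u v : Tan n M x), h x u v = h x v u) {ε ζ : ℝ} {a b c : GenSec n M}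
    (ha : IsGraphOf h ε a) (hb : IsGraphOf h (-ε) b) (hc : IsGraphOf h ζ c)
    (hac : ∀ y, h y (a y).1 (c y).1 = 0) (hbc : ∀ y, h y (b y).1 (c y).1 = 0) (x : M) :
    courantElement a b c x = (1 / 2) * (ζ * h x (lieBr (anchor a) (anchor b) x) (c x).1
      + ε * lieTwo (anchor c) h x (a x).1 (b x).1) := by
  have h1 := lieTwo_apply (anchor c) (anchor a) (anchor b) h x
  change lieTwo (anchor c) h x (a x).1 (b x).1 =
    mvfderiv (𝓡 n) (fun y => h y (a y).1 (b y).1) x (c x).1 -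
    h x (mlieBracket (𝓡 n) (anchor c) (anchor a) x) (b x).1 -
    h x (a x).1 (mlieBracket (𝓡 n) (anchor c) (anchor b) x) at h1
  rw [ha.courantElement_apply hb hc, h1, mvfderiv_eq_zero_of_forall hac,
    mvfderiv_eq_zero_of_forall hbc, mlieBracket_swap_apply (V := anchor c) (W := anchor a),
    mlieBracket_swap_apply (V := anchor c) (W := anchor b), hs x _ (b x).1, hs x _ (c x).1,
    map_neg, map_neg]
  change _ = (1 / 2) * (ζ * h x (c x).1 (mlieBracket (𝓡 n) (anchor a) (anchor b) x) + _)
  ring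

/-- The analogue of `courantElement_graph_right` with the orthogonal vector field in the second
argument. -/
theorem courantElement_graph_middle {h : TwoTensor n M}
    (hs : ∀ (x : M) (u v : Tan n M x), h x u v = h x v u) {ε δ : ℝ} {a b c : GenSec n M}
    (ha : IsGraphOf h ε a) (hb : IsGraphOf h δ b) (hc : IsGraphOf h (-ε) c)
    (hab : ∀ y, h y (a y).1 (b y).1 = 0) (hbc : ∀ y, h y (b y).1 (c y).1 = 0) (x : M) :
    courantElement a b c x = -(1 / 2) * (δ * h x (lieBr (anchor a) (anchor c) x) (b x).1
      + ε * lieTwo (anchor b) h x (a x).1 (c x).1) := by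
  have h1 := lieTwo_apply (anchor b) (anchor a) (anchor c) h x
  change lieTwo (anchor b) h x (a x).1 (c x).1 =
    mvfderiv (𝓡 n) (fun y => h y (a y).1 (c y).1) x (b x).1 -
    h x (mlieBracket (𝓡 n) (anchor b) (anchor a) x) (c x).1 -
    h x (a x).1 (mlieBracket (𝓡 n) (anchor b) (anchor c) x) at h1
  rw [ha.courantElement_apply hb hc, h1, mvfderiv_eq_zero_of_forall hab,
    mvfderiv_eq_zero_of_forall hbc, mlieBracket_swap_apply (V := anchor b) (W := anchor a),
    hs x _ (c x).1, hs x _ (b x).1, map_neg]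
  change _ = -(1 / 2) * (δ * h x (b x).1 (mlieBracket (𝓡 n) (anchor a) (anchor c) x) + _)
  ring

/-- The analogue of `courantElement_graph_right` with the orthogonal vector field in the first
argument. -/
theorem courantElement_graph_left {h : TwoTensor n M}
    (hs : ∀ (x : M) (u v : Tan n M x), h x u v = h x v u) {ε δ : ℝ} {a b c : GenSec n M}
    (ha : IsGraphOf h ε a) (hb : IsGraphOf h δ b) (hc : IsGraphOf h (-δ) c)
    (hab : ∀ y, h y (a y).1 (b y).1 = 0) (hac : ∀ y, h y (a y).1 (c y).1 = 0) (x : M) :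
    courantElement a b c x = (1 / 2) * (ε * h x (lieBr (anchor b) (anchor c) x) (a x).1
      + δ * lieTwo (anchor a) h x (b x).1 (c x).1) := by
  have h1 := lieTwo_apply (anchor a) (anchor b) (anchor c) h x
  change lieTwo (anchor a) h x (b x).1 (c x).1 =
    mvfderiv (𝓡 n) (fun y => h y (b y).1 (c y).1) x (a x).1 -
    h x (mlieBracket (𝓡 n) (anchor a) (anchor b) x) (c x).1 -
    h x (b x).1 (mlieBracket (𝓡 n) (anchor a) (anchor c) x) at h1
  rw [ha.courantElement_apply hb hc, h1, mvfderiv_eq_zero_of_forall hab,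
    mvfderiv_eq_zero_of_forall hac, hs x _ (c x).1, hs x _ (a x).1]
  change _ = (1 / 2) * (ε * h x (a x).1 (mlieBracket (𝓡 n) (anchor b) (anchor c) x) + _)
  ring

/-! ### Eigenbundles of a pair of commuting generalized metrics -/

/-- A vector field, regarded as a section of `TM ⊕ T^*M`. -/
def vecToGen (X : VecField n M) : GenSec n M :=
  ⟨fun x => (X x, 0), fun x => contMDiff_gen (X.contMDiff x) ((0 : OneForm n M).contMDiff x)⟩

theorem mem_eigenDist {g₀ g₁ : PseudoMetric n M} {σ : ℝ} {x : M} {v : Tan n M x} :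
    v ∈ eigenDist g₀ g₁ σ x ↔ g₁.flat x v = σ • g₀.flat x v := by
  rw [eigenDist, Module.End.mem_eigenspace_iff]
  change (g₀.flat x).symm (g₁.flat x v) = σ • v ↔ _
  rw [LinearEquiv.symm_apply_eq, map_smul]

/-- Opposite eigenbundles are orthogonal. -/
theorem eigenDist_orthogonal {g₀ g₁ : PseudoMetric n M} {σ : ℝ} (hσ : σ ≠ 0) {x : M}
    {v w : Tan n M x} (hv : v ∈ eigenDist g₀ g₁ σ x) (hw : w ∈ eigenDist g₀ g₁ (-σ) x) :
    g₀.toTwoTensor x v w = 0 := by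
  have h1 : g₁.toTwoTensor x v w = σ * g₀.toTwoTensor x v w :=
    DFunLike.congr_fun (mem_eigenDist.1 hv) w
  have h2 : g₁.toTwoTensor x w v = -σ * g₀.toTwoTensor x w v :=
    DFunLike.congr_fun (mem_eigenDist.1 hw) v
  rw [g₁.symm, g₀.symm x w v, h1] at h2
  have h3 : σ * g₀.toTwoTensor x v w = 0 := by linarith
  exact (mul_eq_zero.1 h3).resolve_left hσ

section Pair

variable {φ : Fin 2 → GenEnd n M} {g : Fin 2 → PseudoMetric n M}

/-- Commuting of the two generalized metrics means `T² = 1`. -/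
theorem productStructure_sq (hφ : ∀ i, IsClassicalMetric (φ i) (g i))
    (hcomm : ∀ (x : M) (u : GenTan n M x), φ 0 x (φ 1 x u) = φ 1 x (φ 0 x u))
    (x : M) (v : Tan n M x) :
    productStructure (g 0) (g 1) x (productStructure (g 0) (g 1) x v) = v := by
  have h := congrArg Prod.fst (hcomm x (v, 0))
  rw [hφ 0, hφ 1, hφ 0, hφ 1] at h
  change ((g 0).flat x).symm ((g 1).flat x v) = ((g 1).flat x).symm ((g 0).flat x v) at h
  change ((g 0).flat x).symm ((g 1).flat x (((g 0).flat x).symm ((g 1).flat x v))) = v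
  rw [h, LinearEquiv.apply_symm_apply, LinearEquiv.symm_apply_apply]

/-- As `T² = 1`, the operator `1 + σ T` maps into the `σ`-eigenbundle for `σ = ±1`. -/
theorem add_smul_productStructure_mem (hφ : ∀ i, IsClassicalMetric (φ i) (g i))
    (hcomm : ∀ (x : M) (u : GenTan n M x), φ 0 x (φ 1 x u) = φ 1 x (φ 0 x u))
    {σ : ℝ} (hσ : σ * σ = 1) (x : M) (v : Tan n M x) :
    v + σ • productStructure (g 0) (g 1) x v ∈ eigenDist (g 0) (g 1) σ x := by
  rw [eigenDist, Module.End.mem_eigenspace_iff, map_add, map_smul,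
    productStructure_sq hφ hcomm, smul_add, smul_smul, hσ, one_smul, add_comm]

/-- Each eigenbundle contains the orthogonal complement of the opposite one. -/
theorem mem_eigenDist_of_orthogonal (hφ : ∀ i, IsClassicalMetric (φ i) (g i))
    (hcomm : ∀ (x : M) (u : GenTan n M x), φ 0 x (φ 1 x u) = φ 1 x (φ 0 x u))
    {σ : ℝ} (hσ : σ * σ = 1) {x : M} {v : Tan n M x}
    (h : ∀ w ∈ eigenDist (g 0) (g 1) (-σ) x, (g 0).toTwoTensor x v w = 0) :
    v ∈ eigenDist (g 0) (g 1) σ x := by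
  have hσ' : -σ * -σ = 1 := by rw [neg_mul_neg, hσ]
  have hσ0 : σ ≠ 0 := fun h0 => by simp [h0] at hσ
  set p := v + σ • productStructure (g 0) (g 1) x v with hp
  set q := v + (-σ) • productStructure (g 0) (g 1) x v with hq
  have hpm : p ∈ eigenDist (g 0) (g 1) σ x := add_smul_productStructure_mem hφ hcomm hσ x v
  have hqm : q ∈ eigenDist (g 0) (g 1) (-σ) x := add_smul_productStructure_mem hφ hcomm hσ' x v
  have hpq : p = (2 : ℝ) • v - q := by rw [hp, hq]; module
  -- `q` is orthogonal to both eigenbundles, hence zero.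
  have hq0 : q = 0 := by
    refine (g 0).nondegenerate x q fun w => ?_
    have hw : (2 : ℝ) • w = (w + σ • productStructure (g 0) (g 1) x w) +
      (w + (-σ) • productStructure (g 0) (g 1) x w) := by module
    have h1 := eigenDist_orthogonal hσ0 (add_smul_productStructure_mem hφ hcomm hσ x w) hqm
    have hwm := add_smul_productStructure_mem hφ hcomm hσ' x w
    have h2 := eigenDist_orthogonal hσ0 hpm hwm
    have h3 := h _ hwm
    rw [(g 0).symm] at h1
    rw [hpq, map_sub, map_smul] at h2
    change (2 : ℝ) * (g 0).toTwoTensor x v _ - (g 0).toTwoTensor x q _ = 0 at h2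
    rw [h3] at h2
    have h4 : (2 : ℝ) * (g 0).toTwoTensor x q w = 0 := by
      rw [← smul_eq_mul, ← map_smul, hw, map_add, h1]
      linarith
    linarith
  have hv : v = (1 / 2 : ℝ) • p := by
    rw [hpq, hq0]
    module
  rw [hv]
  exact Submodule.smul_mem _ _ hpm

theorem IsClassicalMetric.apply_apply {ψ : GenEnd n M} {h : PseudoMetric n M}
    (hψ : IsClassicalMetric ψ h) (x : M) (u : GenTan n M x) : ψ x (ψ x u) = u := by
  rw [hψ x u.1 u.2, hψ, LinearEquiv.symm_apply_apply, LinearEquiv.apply_symm_apply]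

/-- An eigensection for the eigenvalues `s` is `X + s₁ g₁(X)`. -/
theorem IsEigensection.isGraphOf (hφ : ∀ i, IsClassicalMetric (φ i) (g i)) {s : Fin 2 → ℝ}
    (hs : s 0 * s 0 = 1) {a : GenSec n M} (ha : IsEigensection φ s a) :
    IsGraphOf (g 0).toTwoTensor (s 0) a := by
  intro y
  have h : φ 0 y (a y) = s 0 • a y := DFunLike.congr_fun (ha 0) y
  have h1 : (g 0).flat y (a y).1 = s 0 • (a y).2 := by
    have := congrArg Prod.snd h
    rwa [hφ 0 y (a y).1 (a y).2] at this
  change (a y).2 = s 0 • (g 0).flat y (a y).1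
  rw [h1, smul_smul, hs, one_smul]

/-- The vector field of an eigensection for the eigenvalues `s` is `s₁ s₂`-eigen for `T`. -/
theorem IsEigensection.anchor_mem (hφ : ∀ i, IsClassicalMetric (φ i) (g i)) {s : Fin 2 → ℝ}
    (hs : s 0 * s 0 = 1) {a : GenSec n M} (ha : IsEigensection φ s a) :
    anchor a ∈ sectionsOf (eigenDist (g 0) (g 1) (s 0 * s 1)) := by
  intro y
  have h : φ 1 y (a y) = s 1 • a y := DFunLike.congr_fun (ha 1) y
  have h1 : (g 1).flat y (a y).1 = s 1 • (a y).2 := by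
    have := congrArg Prod.snd h
    rwa [hφ 1 y (a y).1 (a y).2] at this
  refine mem_eigenDist.2 (h1.trans ?_)
  rw [ha.isGraphOf hφ hs y, smul_smul, mul_comm]
  rfl

/-- The section `X + ε g₁(X)`. -/
def graphSec (φ : Fin 2 → GenEnd n M) (ε : ℝ) (X : VecField n M) : GenSec n M :=
  vecToGen X + ε • endAct (φ 0) (vecToGen X)

theorem graphSec_apply (hφ : ∀ i, IsClassicalMetric (φ i) (g i)) (ε : ℝ) (X : VecField n M)
    (x : M) : graphSec φ ε X x = (X x, ε • (g 0).flat x (X x)) := by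
  change ((X x, 0) : GenTan n M x) + ε • φ 0 x (X x, 0) = _
  rw [hφ 0 x, map_zero, Prod.smul_mk, smul_zero, Prod.mk_add_mk, add_zero, zero_add]

theorem isEigensection_graphSec (hφ : ∀ i, IsClassicalMetric (φ i) (g i)) {ε σ : ℝ}
    (hε : ε * ε = 1) (hσ : σ * σ = 1) {X : VecField n M}
    (hX : X ∈ sectionsOf (eigenDist (g 0) (g 1) σ)) :
    IsEigensection φ ![ε, ε * σ] (graphSec φ ε X) := by
  intro i
  ext x : 1
  change φ i x (graphSec φ ε X x) = (![ε, ε * σ] : Fin 2 → ℝ) i • graphSec φ ε X x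
  rw [graphSec_apply hφ, hφ i x, map_smul]
  have hx := mem_eigenDist.1 (hX x)
  fin_cases i
  · simp [smul_smul, hε]
  · have h1 : ((g 1).flat x).symm ((g 0).flat x (X x)) = σ • X x := by
      rw [LinearEquiv.symm_apply_eq, map_smul, hx, smul_smul, hσ, one_smul]
    have h2 : ε * σ * ε = σ := by rw [mul_right_comm, hε, one_mul]
    simp [smul_smul, h1, hx, h2]

/-- The joint eigensections span all sections: `φ₁` and `φ₂` are commuting involutions. -/
theorem eigensection_induction (hφ : ∀ i, IsClassicalMetric (φ i) (g i))
    (hcomm : ∀ (x : M) (u : GenTan n M x), φ 0 x (φ 1 x u) = φ 1 x (φ 0 x u))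
    {p : GenSec n M → Prop} (hadd : ∀ a b, p a → p b → p (a + b))
    (heig : ∀ (s : Fin 2 → ℝ) (a : GenSec n M), (∀ i, s i = 1 ∨ s i = -1) →
      IsEigensection φ s a → p a) (a : GenSec n M) : p a := by
  have h00 (a : GenSec n M) : endAct (φ 0) (endAct (φ 0) a) = a := by
    ext x : 1
    exact (hφ 0).apply_apply x (a x)
  have h11 (a : GenSec n M) : endAct (φ 1) (endAct (φ 1) a) = a := by
    ext x : 1
    exact (hφ 1).apply_apply x (a x)
  have h10 (a : GenSec n M) :
      endAct (φ 1) (endAct (φ 0) a) = endAct (φ 0) (endAct (φ 1) a) := by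
    ext x : 1
    exact (hcomm x (a x)).symm
  -- The projection to the joint eigenbundle is `(1 + ε φ₁) (1 + δ φ₂) / 4`.
  have key (ε δ : ℝ) (hε : ε = 1 ∨ ε = -1) (hδ : δ = 1 ∨ δ = -1) :
      p ((1 / 4 : ℝ) • (a + ε • endAct (φ 0) a + δ • endAct (φ 1) a +
        (ε * δ) • endAct (φ 0) (endAct (φ 1) a))) := by
    refine heig ![ε, δ] _ (Fin.forall_fin_two.2 ⟨hε, hδ⟩) (Fin.forall_fin_two.2 ⟨?_, ?_⟩)
    · simp only [map_smul, map_add, h00, Matrix.cons_val_zero]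
      rcases hε with rfl | rfl <;> module
    · change _ = δ • _
      simp only [map_smul, map_add, h11, h10]
      rcases hδ with rfl | rfl <;> module
  have hsum := hadd _ _
    (hadd _ _ (key 1 1 (.inl rfl) (.inl rfl)) (key 1 (-1) (.inl rfl) (.inr rfl)))
    (hadd _ _ (key (-1) 1 (.inr rfl) (.inl rfl)) (key (-1) (-1) (.inr rfl) (.inr rfl)))
  convert hsum using 1
  module

/-- Distinct sign vectors with the same product of entries have opposite first
entries. -/
theorem eq_neg_of_sign_mul_eq {s t : Fin 2 → ℝ} (hs : ∀ i, s i = 1 ∨ s i = -1)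
    (ht : ∀ i, t i = 1 ∨ t i = -1) (hst : s ≠ t) (h : s 0 * s 1 = t 0 * t 1) : t 0 = -s 0 := by
  by_contra h0
  have h0' : s 0 = t 0 := by
    rcases hs 0 with h1 | h1 <;> rcases ht 0 with h2 | h2 <;> simp [h1, h2] at h0 ⊢
  have hne : t 0 ≠ 0 := by rcases ht 0 with h2 | h2 <;> simp [h2]
  rw [h0'] at h
  exact hst (funext (Fin.forall_fin_two.2 ⟨h0', mul_left_cancel₀ hne h⟩))

theorem eq_neg_of_sign_ne {ε δ : ℝ} (hε : ε = 1 ∨ ε = -1)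
    (hδ : δ = 1 ∨ δ = -1) (h : ε ≠ δ) : δ = -ε := by
  rcases hε with rfl | rfl <;> rcases hδ with rfl | rfl <;> simp at h ⊢

end Pair

/-! ### Extension of vectors to global sections -/

/-- Every tangent vector extends to a global smooth vector field. -/
theorem exists_vecField_apply_eq [T2Space M] [SecondCountableTopology M] (x : M) (v : Tan n M x) :
    ∃ X : VecField n M, X x = v := by
  have : LocallyCompactSpace M := ChartedSpace.locallyCompactSpace (Model n) M
  classical
  -- A global section of the convex sets `{v}` at `x` and `univ` elsewhere, glued from local ones.
  obtain ⟨X, hX⟩ := exists_contMDiffSection_forall_mem_convex_of_local (𝓡 n) (n := ⊤)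
    (F_fiber := Model n) (fun y : M => Tan n M y) (fun y => {w | ∀ h : y = x, w = h ▸ v})
    (fun y => by
      by_cases h : y = x
      · subst h
        simp
      · simpa [h] using convex_univ)
    (fun x₀ => by
      by_cases h : x₀ = x
      · subst h
        obtain ⟨U, hU, hUσ⟩ := FiberBundle.exists_contMDiffOn_extend (k := ∞) (𝓡 n) (Model n) v
        refine ⟨U, hU, FiberBundle.extend (Model n) v, hUσ, fun y _ hy => ?_⟩
        subst hy
        simp
      · refine ⟨{x}ᶜ, isOpen_compl_singleton.mem_nhds h, (0 : VecField n M),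
          (0 : VecField n M).contMDiff.contMDiffOn, fun y hy hyx => absurd hyx hy⟩)
  exact ⟨X, hX x rfl⟩

variable {φ : Fin 2 → GenEnd n M} {g : Fin 2 → PseudoMetric n M}

/-- Every vector of an eigenbundle extends to a global smooth section of it. -/
theorem exists_sectionsOf_eigenDist [T2Space M] [SecondCountableTopology M]
    (hφ : ∀ i, IsClassicalMetric (φ i) (g i))
    (hcomm : ∀ (x : M) (u : GenTan n M x), φ 0 x (φ 1 x u) = φ 1 x (φ 0 x u))
    {σ : ℝ} (hσ : σ * σ = 1) {x : M} {v : Tan n M x}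
    (hv : v ∈ eigenDist (g 0) (g 1) σ x) :
    ∃ X ∈ sectionsOf (eigenDist (g 0) (g 1) σ), X x = v := by
  obtain ⟨W, hW⟩ := exists_vecField_apply_eq x v
  -- Project `W` to the eigenbundle by `(1 + σ T) / 2`, where `T = φ₁ φ₂` on vector fields.
  let X : VecField n M :=
    anchor ((1 / 2 : ℝ) • (vecToGen W + σ • endAct (φ 0) (endAct (φ 1) (vecToGen W))))
  have hX (y : M) :
      X y = (1 / 2 : ℝ) • (W y + σ • productStructure (g 0) (g 1) y (W y)) := by
    change (1 / 2 : ℝ) • (W y + σ • (φ 0 y (φ 1 y (W y, 0))).1) = _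
    rw [hφ 1, hφ 0]
    rfl
  refine ⟨X, fun y => ?_, ?_⟩
  · rw [hX]
    exact Submodule.smul_mem _ _ (add_smul_productStructure_mem hφ hcomm hσ y _)
  · rw [hX, hW, Module.End.mem_eigenspace_iff.1 hv, smul_smul, hσ]
    module

/-! ### Uniform integrability and the two obstructions -/

/-- Sufficiency: on joint eigensections whose eigenvalues are pairwise distinct, two of the
underlying vector fields lie in one eigenbundle of `T` and the third in the other, and `τ_C` is a
combination of the two obstructions. -/
theorem courantElement_eq_zero (hφ : ∀ i, IsClassicalMetric (φ i) (g i))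
    (hI : ∀ σ : ℝ, σ = 1 ∨ σ = -1 → IsInvolutive (eigenDist (g 0) (g 1) σ))
    (hL : ∀ σ : ℝ, σ = 1 ∨ σ = -1 → ∀ X ∈ sectionsOf (eigenDist (g 0) (g 1) σ),
      LieVanishesOn X (g 0) (eigenDist (g 0) (g 1) (-σ)))
    {s t u : Fin 2 → ℝ} (hs : ∀ i, s i = 1 ∨ s i = -1) (ht : ∀ i, t i = 1 ∨ t i = -1)
    (hu : ∀ i, u i = 1 ∨ u i = -1) (hst : s ≠ t) (htu : t ≠ u) (hsu : s ≠ u)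
    {a b c : GenSec n M} (ha : IsEigensection φ s a) (hb : IsEigensection φ t b)
    (hc : IsEigensection φ u c) : courantElement a b c = 0 := by
  have hsq {r : ℝ} (hr : r = 1 ∨ r = -1) : r * r = 1 := by rcases hr with rfl | rfl <;> norm_num
  have hmul {r r' : ℝ} (hr : r = 1 ∨ r = -1) (hr' : r' = 1 ∨ r' = -1) :
      r * r' = 1 ∨ r * r' = -1 := by
    rcases hr with rfl | rfl <;> rcases hr' with rfl | rfl <;> norm_num
  have hne {r : ℝ} (hr : r = 1 ∨ r = -1) : r ≠ 0 := by rcases hr with rfl | rfl <;> norm_num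
  have ga := ha.isGraphOf hφ (hsq (hs 0))
  have gb := hb.isGraphOf hφ (hsq (ht 0))
  have gc := hc.isGraphOf hφ (hsq (hu 0))
  have ma := ha.anchor_mem hφ (hsq (hs 0))
  have mb := hb.anchor_mem hφ (hsq (ht 0))
  have mc := hc.anchor_mem hφ (hsq (hu 0))
  have σa := hmul (hs 0) (hs 1)
  have σb := hmul (ht 0) (ht 1)
  have σc := hmul (hu 0) (hu 1)
  have hsymm := (g 0).symm
  have orth {σ : ℝ} (hσ : σ = 1 ∨ σ = -1) {X Y : VecField n M}
      (hX : X ∈ sectionsOf (eigenDist (g 0) (g 1) σ))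
      (hY : Y ∈ sectionsOf (eigenDist (g 0) (g 1) (-σ))) (y : M) :
      (g 0).toTwoTensor y (X y) (Y y) = 0 ∧ (g 0).toTwoTensor y (Y y) (X y) = 0 := by
    have := eigenDist_orthogonal (hne hσ) (hX y) (hY y)
    exact ⟨this, (hsymm y _ _).trans this⟩
  have neg {σ : ℝ} (hσ : σ = 1 ∨ σ = -1) : -σ = 1 ∨ -σ = -1 := by
    rcases hσ with rfl | rfl <;> norm_num
  have lie {σ : ℝ} (hσ : σ = 1 ∨ σ = -1) {X : VecField n M}
      (hX : X ∈ sectionsOf (eigenDist (g 0) (g 1) (-σ))) :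
      LieVanishesOn X (g 0) (eigenDist (g 0) (g 1) σ) := by
    have := hL (-σ) (neg hσ) X hX
    rwa [neg_neg] at this
  ext x
  change courantElement a b c x = 0
  -- Two of the products `s₁ s₂`, `t₁ t₂`, `u₁ u₂` agree; all three cannot, since each value is
  -- taken by only two points of `{±1}²`.
  by_cases h1 : s 0 * s 1 = t 0 * t 1
  · have h2 : s 0 * s 1 ≠ u 0 * u 1 := fun h2 => htu (funext (by
      have e1 := eq_neg_of_sign_mul_eq hs ht hst h1
      have e2 := eq_neg_of_sign_mul_eq hs hu hsu h2
      have e3 : t 0 = u 0 := e1.trans e2.symm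
      exact Fin.forall_fin_two.2 ⟨e3, mul_left_cancel₀ (hne (ht 0)) (by rw [← h1, h2, e3])⟩))
    rw [← h1] at mb
    rw [eq_neg_of_sign_ne σa σc h2] at mc
    rw [eq_neg_of_sign_mul_eq hs ht hst h1] at gb
    have e1 : (g 0).toTwoTensor x (lieBr (anchor a) (anchor b) x) (c x).1 = 0 :=
      (orth σa (hI _ σa _ ma _ mb) mc x).1
    rw [courantElement_graph_right hsymm ga gb gc (fun y => (orth σa ma mc y).1)
      (fun y => (orth σa mb mc y).1), e1, lie σa mc x (a x).1 (ma x) (b x).1 (mb x)]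
    simp
  · by_cases h2 : s 0 * s 1 = u 0 * u 1
    · rw [← h2] at mc
      rw [eq_neg_of_sign_ne σa σb h1] at mb
      rw [eq_neg_of_sign_mul_eq hs hu hsu h2] at gc
      have e1 : (g 0).toTwoTensor x (lieBr (anchor a) (anchor c) x) (b x).1 = 0 :=
        (orth σa (hI _ σa _ ma _ mc) mb x).1
      rw [courantElement_graph_middle hsymm ga gb gc (fun y => (orth σa ma mb y).1)
        (fun y => (orth σa mc mb y).2), e1, lie σa mb x (a x).1 (ma x) (c x).1 (mc x)]
      simp
    · have h3 : t 0 * t 1 = u 0 * u 1 :=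
        (eq_neg_of_sign_ne σa σb h1).trans (eq_neg_of_sign_ne σa σc h2).symm
      rw [← h3] at mc
      rw [eq_neg_of_sign_ne σb σa (Ne.symm h1)] at ma
      rw [eq_neg_of_sign_mul_eq ht hu htu h3] at gc
      have e1 : (g 0).toTwoTensor x (lieBr (anchor b) (anchor c) x) (a x).1 = 0 :=
        (orth σb (hI _ σb _ mb _ mc) ma x).1
      rw [courantElement_graph_left hsymm ga gb gc (fun y => (orth σb mb ma y).2)
        (fun y => (orth σb mc ma y).2), e1, lie σb ma x (b x).1 (mb x) (c x).1 (mc x)]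
      simp

/-- Necessity: the Vandermonde polynomial detects both obstructions, which are separated by the
choice of sign in `Z ± g₁(Z)`. -/
theorem obstructions_eq_zero (hφ : ∀ i, IsClassicalMetric (φ i) (g i))
    (h : UniformlyIntegrable (fun _ => 1) φ) {σ : ℝ} (hσ : σ = 1 ∨ σ = -1) {X Y Z : VecField n M}
    (hX : X ∈ sectionsOf (eigenDist (g 0) (g 1) σ)) (hY : Y ∈ sectionsOf (eigenDist (g 0) (g 1) σ))
    (hZ : Z ∈ sectionsOf (eigenDist (g 0) (g 1) (-σ))) (x : M) :
    (g 0).toTwoTensor x (lieBr X Y x) (Z x) = 0 ∧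
      lieTwo Z (g 0).toTwoTensor x (X x) (Y x) = 0 := by
  have hσ2 : σ * σ = 1 := by rcases hσ with rfl | rfl <;> norm_num
  have hσ0 : σ ≠ 0 := by rcases hσ with rfl | rfl <;> norm_num
  have graph (ε : ℝ) (W : VecField n M) :
      IsGraphOf (g 0).toTwoTensor ε (graphSec φ ε W) := fun y => by
    rw [graphSec_apply hφ]
    rfl
  have anch (ε : ℝ) (W : VecField n M) : anchor (graphSec φ ε W) = W := by
    ext y : 1
    exact congrArg Prod.fst (graphSec_apply hφ ε W y)
  have anch' (ε : ℝ) (W : VecField n M) (y : M) : (graphSec φ ε W y).1 = W y :=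
    congrArg Prod.fst (graphSec_apply hφ ε W y)
  have key (ζ : ℝ) (hζ : ζ = 1 ∨ ζ = -1) :
      ζ * (g 0).toTwoTensor x (lieBr X Y x) (Z x) +
        lieTwo Z (g 0).toTwoTensor x (X x) (Y x) = 0 := by
    have hζ2 : ζ * ζ = 1 := by rcases hζ with rfl | rfl <;> norm_num
    have h0 := h vandermondePoly_mem (graphSec φ 1 X) (graphSec φ (-1) Y) (graphSec φ ζ Z)
    rw [polyAct_eigensections (isEigensection_graphSec hφ (by norm_num) hσ2 hX)
      (isEigensection_graphSec hφ (by norm_num) hσ2 hY)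
      (isEigensection_graphSec hφ hζ2 (by linarith) hZ), eval_vandermondePoly] at h0
    have h1 := DFunLike.congr_fun ((smul_eq_zero.1 h0).resolve_left (by
      rcases hσ with rfl | rfl <;> rcases hζ with rfl | rfl <;> norm_num)) x
    rw [courantElement_graph_right (g 0).symm (graph 1 X) (graph (-1) Y) (graph ζ Z)
      (fun y => by rw [anch', anch']; exact eigenDist_orthogonal hσ0 (hX y) (hZ y))
      (fun y => by rw [anch', anch']; exact eigenDist_orthogonal hσ0 (hY y) (hZ y)),
      anch, anch, anch, anch', anch', anch'] at h1
    change (1 / 2) * _ = (0 : ℝ) at h1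
    linarith
  have h1 := key 1 (.inl rfl)
  have h2 := key (-1) (.inr rfl)
  constructor <;> linarith

end
end GenGeom
end

theorem mainTheorem6 {n : ℕ} {M : Type*} [TopologicalSpace M] [T2Space M]
    [SecondCountableTopology M] [ChartedSpace (GenGeom.Model n) M] [IsManifold (𝓡 n) ∞ M]
    (φ : Fin 2 → GenGeom.GenEnd n M) (g : Fin 2 → GenGeom.PseudoMetric n M)
    (hφ : ∀ i, GenGeom.IsClassicalMetric (φ i) (g i))
    (hcomm : ∀ (x : M) (u : GenGeom.GenTan n M x), φ 0 x (φ 1 x u) = φ 1 x (φ 0 x u)) :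
    GenGeom.UniformlyIntegrable (fun _ => 1) φ ↔
      (GenGeom.IsInvolutive (GenGeom.eigenDist (g 0) (g 1) 1) ∧
        GenGeom.IsInvolutive (GenGeom.eigenDist (g 0) (g 1) (-1))) ∧
      (∀ X ∈ GenGeom.sectionsOf (GenGeom.eigenDist (g 0) (g 1) 1),
        GenGeom.LieVanishesOn X (g 0) (GenGeom.eigenDist (g 0) (g 1) (-1))) ∧
      (∀ Y ∈ GenGeom.sectionsOf (GenGeom.eigenDist (g 0) (g 1) (-1)),
        GenGeom.LieVanishesOn Y (g 0) (GenGeom.eigenDist (g 0) (g 1) 1)) := by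
  open GenGeom in
  have hsq {σ : ℝ} (hσ : σ = 1 ∨ σ = -1) : σ * σ = 1 := by rcases hσ with rfl | rfl <;> norm_num
  constructor
  · intro h
    have hI (σ : ℝ) (hσ : σ = 1 ∨ σ = -1) : IsInvolutive (eigenDist (g 0) (g 1) σ) := by
      intro X hX Y hY x
      refine mem_eigenDist_of_orthogonal hφ hcomm (hsq hσ) fun w hw => ?_
      obtain ⟨Z, hZ, rfl⟩ := exists_sectionsOf_eigenDist hφ hcomm
        ((neg_mul_neg σ σ).trans (hsq hσ)) hw
      exact (obstructions_eq_zero hφ h hσ hX hY hZ x).1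
    have hL (σ : ℝ) (hσ : σ = 1 ∨ σ = -1) (Z : VecField n M)
        (hZ : Z ∈ sectionsOf (eigenDist (g 0) (g 1) (-σ))) :
        LieVanishesOn Z (g 0) (eigenDist (g 0) (g 1) σ) := by
      intro x v hv w hw
      obtain ⟨X, hX, rfl⟩ := exists_sectionsOf_eigenDist hφ hcomm (hsq hσ) hv
      obtain ⟨Y, hY, rfl⟩ := exists_sectionsOf_eigenDist hφ hcomm (hsq hσ) hw
      exact (obstructions_eq_zero hφ h hσ hX hY hZ x).2
    refine ⟨⟨hI 1 (.inl rfl), hI (-1) (.inr rfl)⟩, fun X hX => ?_, hL 1 (.inl rfl)⟩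
    exact hL (-1) (.inr rfl) X (by rwa [neg_neg])
  · rintro ⟨⟨hI₁, hI₂⟩, hL₁, hL₂⟩ P hP a b c
    have hI (σ : ℝ) (hσ : σ = 1 ∨ σ = -1) : IsInvolutive (eigenDist (g 0) (g 1) σ) := by
      rcases hσ with rfl | rfl
      exacts [hI₁, hI₂]
    have hL (σ : ℝ) (hσ : σ = 1 ∨ σ = -1) : ∀ X ∈ sectionsOf (eigenDist (g 0) (g 1) σ),
        LieVanishesOn X (g 0) (eigenDist (g 0) (g 1) (-σ)) := by
      rcases hσ with rfl | rfl
      · exact hL₁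
      · rw [neg_neg]
        exact hL₂
    rw [← polyActLinear_apply]
    refine eigensection_induction hφ hcomm
      (p := fun a => polyActLinear φ a b c P = 0) (fun a a' h h' => by
        rw [polyActLinear_add_left, h, h', add_zero]) (fun s a hs ha => ?_) a
    refine eigensection_induction hφ hcomm
      (p := fun b => polyActLinear φ a b c P = 0) (fun b b' h h' => by
        rw [polyActLinear_add_middle, h, h', add_zero]) (fun t b ht hb => ?_) b
    refine eigensection_induction hφ hcomm
      (p := fun c => polyActLinear φ a b c P = 0) (fun c c' h h' => by
        rw [polyActLinear_add_right, h, h', add_zero]) (fun u c hu hc => ?_) c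
    rw [polyActLinear_apply, polyAct_eigensections ha hb hc]
    by_cases hstu : s = t ∨ t = u ∨ s = u
    · rw [eval_eq_zero_of_mem_universallyTensorial hP hstu, zero_smul]
    · push Not at hstu
      rw [courantElement_eq_zero hφ hI hL hs ht hu hstu.1 hstu.2.1 hstu.2.2 ha hb hc, smul_zero]
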